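/- **The game.** Let $d,k,m,M$ be integers with $0\le k<d$ and $m,M\ge 0$, let $\alpha,\beta\in(0,1]$, and let $n=\lceil d/4\rceil$ or $n=\lfloor d/4\rfloor$, with $n\ge 1$. Let $\delta>0$ and fix a partition of the sphere $S^{d-1}$ into finitely many measurable cells of equal surface and of diameter at most $\delta$, together with a representative of each cell; let $\phi_\delta$ send a point of $S^{d-1}$ to the representative of its cell. The Orthogonal Vector Game with Hints is played as follows. 1. The oracle samples $A$ uniformly in $\{\pm1\}^{n\times d}$, with rows $a_1,\dots,a_n$, and the player observes $A$. 2. For $l=1,\dots,d$: based on $A$ and on all previous queries and responses, the player submits $r_l\le k$ vectors $x_{l,1},\dots,x_{l,r_l}\in\mathbb R^d$. With $b_{l,1},b_{l,2},\dots$ the Gram–Schmidt decomposition of these vectors, the oracle samples $y_l$ uniformly in $\{z\in S^{d-1}: |b_{l,r}^\top z|\le d^{-3}\ \text{for all } r\}$ and returns the hint $v_l=\phi_\delta(y_l)$. 3. Based on $A$ and on all queries and responses, the player stores a message of $M$ bits and submits a function $g:\mathbb R^d\to(\{a_j: j\le n\}\cup\{v_l: l\le d\})\times\{1,\dots,d^2\}$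 to the oracle. 4. For $i=1,\dots,m$: based only on the message and on the previous queries and responses of this phase, the player submits $z_i\in\mathbb R^d$ and receives $g(z_i)$. 5. Based only on the message and on the queries and responses of phase 4, the player returns $y_1,\dots,y_k\in\mathbb R^d$. The player wins if, for every $i\le k$, $\|y_i\|_2=1$, $\|Ay_i\|_\infty\le\alpha$ and $\|P_{\mathrm{Span}(y_1,\dots,y_{i-1})^\perp}(y_i)\|_2\ge\beta$. The player may be randomized, that is, may draw a strategy at random before the game. **The constant.** A number $c_H>0$ is called admissible if, for all integers $d,k\ge0$, all orthonormal $z_1,\dots,z_k\in\mathbb R^d$, all $t\in(0,1/2]$ and $h$ uniform in $\{\pm1\}^d$, one has $\mathbb P(|z_i^\top h|\le t\ \text{for all } i\le k)\le 2^{-c_Hk}$. **Proposition.** Admissible constants exist. Let $c_H$ be any admissible constant, and suppose that $$k\ \ge\ 20\,\frac{M+3d\log(2d)+1}{c_H\,n}\qquad\text{and}\qquad \alpha\Bigl(\frac{\sqrt d}{\beta}\Bigr)^{5/4}\le\frac12 .$$ If the player wins the game with probability at least $1/2$, then $$m\ \ge\ \frac{c_H}{8(30\log d+c_H)}\,d .$$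 Here $\log$ is the natural logarithm (the statement with base-2 logarithms follows, since its hypothesis is stronger and its conclusion weaker). Moreover, each hint leaks at most $O(k\log d)$ information on $A$: there is a universal constant $C>0$ such that for all $d\ge1$, $n\ge 0$, $0\le k<d$, $M\ge0$, every $\delta>0$, every discretization as above, every deterministic player (or every player given its random seed), every $l\le d$ and every $J\subseteq\{1,\dots,l-1\}$, $$I\bigl(A;\,v_l\,\big|\,(v_j)_{j\in J}\bigr)\ \le\ C\,k\log d .$$ -/

import Mathlib

open MeasureTheory Set
open scoped RealInnerProductSpace

noncomputable section

namespace HintGame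

/-- The Euclidean space `ℝᵈ`. -/
abbrev Vec (d : ℕ) : Type := EuclideanSpace ℝ (Fin d)

/-- The unit sphere of `ℝᵈ`. -/
abbrev UnitSphere (d : ℕ) : Type := Metric.sphere (0 : Vec d) 1

/-- The matrices in `{±1}^{n × d}`; the entries are the units `1` and `-1` of `ℤ`. -/
abbrev SignMatrix (n d : ℕ) : Type := Matrix (Fin n) (Fin d) ℤˣ

/-- A point of the hypercube `{±1}^d`, seen as a vector of `ℝᵈ`. -/
def signVec {d : ℕ} (h : Fin d → ℤˣ) : Vec d := WithLp.toLp 2 fun j => ((h j : ℤ) : ℝ)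

/-- The `j`-th row of a sign matrix, seen as a vector of `ℝᵈ`. -/
def row {n d : ℕ} (A : SignMatrix n d) (j : Fin n) : Vec d := signVec (A j)

open Classical in
/-- `c` is an admissible value of the hypercube constant `c_H`: `c > 0` and, for `h` uniform on
`{±1}^d` and orthonormal `z₁, …, z_k` in `ℝᵈ`,
`ℙ (|⟨zᵢ, h⟩| ≤ t for all i) ≤ 2^(-c k)` whenever `0 < t ≤ 1/2`, for all `d` and `k`. -/
def IsHypercubeConstant (c : ℝ) : Prop :=
  0 < c ∧ ∀ (d k : ℕ) (z : Fin k → Vec d), Orthonormal ℝ z → ∀ t : ℝ, 0 < t → t ≤ 1 / 2 →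
    ((Finset.univ.filter fun h : Fin d → ℤˣ => ∀ i, |⟪z i, signVec h⟫| ≤ t).card : ℝ) / 2 ^ d
      ≤ (2 : ℝ) ^ (-(c * k))

/-! ### Discretizations of the sphere -/

/-- The (unnormalized) rotation-invariant surface measure of the unit sphere. -/
def surface (d : ℕ) : Measure (UnitSphere d) := (volume : Measure (Vec d)).toSphere

/-- A partition of the unit sphere of `ℝᵈ` into finitely many measurable cells of equal surface
and of diameter at most `δ`, with one representative in each cell. The partition is given by the
map `index` that sends a point to the number of its cell. -/
structure SphereDiscretization (d : ℕ) (δ : ℝ) where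
  /-- the number of cells -/
  N : ℕ
  /-- the cell of a point -/
  index : UnitSphere d → Fin N
  measurable_index : Measurable index
  equal_surface : ∀ i j, surface d (index ⁻¹' {i}) = surface d (index ⁻¹' {j})
  diam_le : ∀ i, Metric.diam (index ⁻¹' {i}) ≤ δ
  /-- the representative of a cell -/
  rep : Fin N → UnitSphere d
  rep_mem : ∀ i, rep i ∈ index ⁻¹' {i}

/-- The discretization function, which sends a point of the sphere to the representative
of its cell. -/
def SphereDiscretization.phi {d : ℕ} {δ : ℝ} (D : SphereDiscretization d δ) (y : UnitSphere d) :
    UnitSphere d := D.rep (D.index y)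

/-! ### The first phase: hints -/

/-- A query of the first phase: at most `k` vectors of `ℝᵈ`. -/
abbrev HintQuery (d k : ℕ) : Type := (r : Fin (k + 1)) × (Fin r → Vec d)

/-- The points of the sphere that are `d⁻³`-almost orthogonal to every vector of the Gram-Schmidt
decomposition of the submitted vectors. (A submitted vector in the span of the preceding ones
contributes the zero vector, hence no constraint.) -/
def slab {d k : ℕ} (q : HintQuery d k) : Set (UnitSphere d) :=
  {z | ∀ i, |⟪InnerProductSpace.gramSchmidtNormed ℝ q.2 i, (z : Vec d)⟫| ≤ ((d : ℝ) ^ 3)⁻¹}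

/-- The law of the vector that the oracle samples: uniform on `slab q`. -/
def oracleLaw {d k : ℕ} (q : HintQuery d k) : Measure (UnitSphere d) :=
  ProbabilityTheory.cond (surface d) (slab q)

/-- The probability that the oracle answers `q` with the representative of the cell `i`. -/
def hintProb {d k : ℕ} {δ : ℝ} (D : SphereDiscretization d δ) (q : HintQuery d k) (i : Fin D.N) :
    ℝ :=
  (oracleLaw q).real {y | D.phi y = D.rep i}

/-! ### Players -/

/-- The transcript of the second phase: the list of the queries made so far, each with its
response, a vector and a number in `[d²]`. -/
abbrev Transcript (d : ℕ) : Type := List (Vec d × (Vec d × Fin (d ^ 2)))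

/-- A (deterministic) strategy for the Orthogonal Vector Game with Hints. In the first phase the
earlier queries are themselves functions of `A` and of the earlier hints, so that a decision based
on `A` and on all previous queries and responses is a function of `A` and of the previous hints. -/
structure Player (d n k M : ℕ) where
  /-- the vectors submitted in round `l` of the first phase, from `A` and the previous hints -/
  submit : SignMatrix n d → (l : Fin d) → (Fin l → Vec d) → HintQuery d k
  /-- the `M`-bit message, from `A` and all hints -/
  message : SignMatrix n d → (Fin d → Vec d) → (Fin M → Bool)
  /-- the function submitted to the oracle, from `A` and all hints: its values are a row of `A`
  or a hint, together with a number in `[d²]` -/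
  response : (A : SignMatrix n d) → (v : Fin d → Vec d) → Vec d →
    ↥(range (row A) ∪ range v) × Fin (d ^ 2)
  /-- the next query of the second phase, from the message and the transcript -/
  query : (Fin M → Bool) → Transcript d → Vec d
  /-- the vectors that are returned at the end, from the message and the transcript -/
  output : (Fin M → Bool) → Transcript d → Fin k → Vec d

namespace Player

variable {d n k M : ℕ}

/-- The transcript of the first `m` queries of the second phase. -/
def transcript (P : Player d n k M) (A : SignMatrix n d) (v : Fin d → Vec d) :
    ℕ → Transcript d
  | 0 => []
  | m + 1 =>
    let T := P.transcript A v m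
    let x := P.query (P.message A v) T
    T ++ [(x, (((P.response A v x).1 : Vec d), (P.response A v x).2))]

/-- The vectors returned after `m` queries. -/
def result (P : Player d n k M) (m : ℕ) (A : SignMatrix n d) (v : Fin d → Vec d) :
    Fin k → Vec d :=
  P.output (P.message A v) (P.transcript A v m)

end Player

/-- The winning condition on the returned vectors: they have unit norm, `‖A yᵢ‖_∞ ≤ α`, and the
projection of `yᵢ` onto the orthogonal complement of the span of the previous ones has norm
at least `β`. -/
def IsWinning {d n k : ℕ} (α β : ℝ) (A : SignMatrix n d) (y : Fin k → Vec d) : Prop :=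
  ∀ i, ‖y i‖ = 1 ∧ (∀ j, |⟪row A j, y i⟫| ≤ α) ∧
    β ≤ ‖(Submodule.span ℝ (y '' Iio i))ᗮ.starProjection (y i)‖

/-! ### The law of the game -/

/-- The randomness of a run of the game: the matrix and the cells of the hints. -/
abbrev Outcome (n : ℕ) {d : ℕ} {δ : ℝ} (D : SphereDiscretization d δ) : Type :=
  SignMatrix n d × (Fin d → Fin D.N)

/-- The matrix of an outcome. -/
def Outcome.matrix {n d : ℕ} {δ : ℝ} {D : SphereDiscretization d δ} (ω : Outcome n D) :
    SignMatrix n d := ω.1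

/-- The hints of an outcome. -/
def Outcome.hints {n d : ℕ} {δ : ℝ} {D : SphereDiscretization d δ} (ω : Outcome n D) :
    Fin d → Vec d := fun l => D.rep (ω.2 l)

/-- The probability of an outcome: `A` is uniform and, given `A` and the previous hints, the next
hint is the answer of the oracle to the vectors submitted by the player. -/
def outcomeProb {d n k M : ℕ} {δ : ℝ} (D : SphereDiscretization d δ) (P : Player d n k M)
    (ω : Outcome n D) : ℝ :=
  (Fintype.card (SignMatrix n d) : ℝ)⁻¹ *
    ∏ l : Fin d, hintProb D
      (P.submit ω.matrix l fun j => ω.hints (Fin.castLE l.isLt.le j)) (ω.2 l)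

open Classical in
/-- The probability that the player wins the game with `m` queries in the second phase. -/
def winProb {d n k M : ℕ} {δ : ℝ} (D : SphereDiscretization d δ) (P : Player d n k M)
    (m : ℕ) (α β : ℝ) : ℝ :=
  ∑ ω : Outcome n D,
    if IsWinning α β ω.matrix (P.result m ω.matrix ω.hints) then outcomeProb D P ω else 0

/-! ### Information -/

open Classical in
/-- The Shannon entropy (with natural logarithms) of `X` under the weights `p`. -/
def entropy {Ω S : Type} [Fintype Ω] [Fintype S] (p : Ω → ℝ) (X : Ω → S) : ℝ :=
  ∑ x : S, Real.negMulLog (∑ ω : Ω, if X ω = x then p ω else 0)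

/-- The conditional mutual information `I(X; Y | Z) = H(X, Z) + H(Y, Z) - H(X, Y, Z) - H(Z)`. -/
def condMutualInfo {Ω S T U : Type} [Fintype Ω] [Fintype S] [Fintype T] [Fintype U]
    (p : Ω → ℝ) (X : Ω → S) (Y : Ω → T) (Z : Ω → U) : ℝ :=
  entropy p (fun ω => (X ω, Z ω)) + entropy p (fun ω => (Y ω, Z ω))
    - entropy p (fun ω => (X ω, Y ω, Z ω)) - entropy p Z

/-- The information on the matrix `A` that the `l`-th hint adds to the hints with indices
in `J`. -/
def hintLeakage {d n k M : ℕ} {δ : ℝ} (D : SphereDiscretization d δ) (P : Player d n k M)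
    (l : Fin d) (J : Finset (Fin d)) : ℝ :=
  condMutualInfo (outcomeProb D P) (fun ω : Outcome n D => ω.1) (fun ω => ω.2 l)
    (fun ω => fun j : J => ω.2 j)

end HintGame

end

/-!
# The Orthogonal Vector Game with Hints

**The hypercube constant.** For orthonormal `z₁, …, z_k` and `h` uniform on `{±1}^d`, the sum of the
squares `⟪zᵢ, h⟫²` has mean `k`, and its lower tail is exponentially small in `k`. This comes from
Maurey's infimum-convolution inequality on the hypercube (`sum_exp_infConv_mul_le`): for a
nonnegative convex `f`, the average of `exp (inf_y f y + |· - y|² / 8)` times that of `exp (-f)` is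
at most one. It is proved by induction on the dimension, from Hölder's inequality and a two-point inequality.

**The hints.** The oracle draws a point of the sphere from a slab whose proportion of the surface is
at least `(12 d^(7/2))^(-k)` (`surface_slab_ge`). As all cells have the same surface, each hint has,
given the matrix and the previous hints, density at most `hintDensity d k = (12 d^(7/2))^k` with
respect to the uniform law on the cells (`hintProb_le`). Comparing entropies with that of the
uniform law bounds the leakage of a hint by `log (hintDensity d k)`, which is `O(k log d)`.

**The number of queries.** The proof is a union bound and needs no entropy. The returned vectors are
determined by the message, the names of the responses (which row or which hint, and which number),
and the values of the rows and hints so named. For a fixed message and fixed names, the joint law of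
the matrix and the used hints has density at most `hintDensity d k ^ m` with respect to the
product of uniform laws (`sum_mul_seqProb_le`), under which the `n - m` or more unused rows are
independent of the returned vectors. If these vectors are robustly independent, a fifth of their
number of orthonormal vectors is almost orthogonal to every row that they are almost orthogonal to
(`exists_orthonormal_of_robust`, by the singular values of the matrix of the vectors), so that each
unused row satisfies the winning condition with probability at most `2^(-c k / 5)`. Altogether the
winning probability is at most
`2^M ((n + d) d²)^m (hintDensity d k)^m 2^(-c k (n - m) / 5)` (`winProb_le`),
which is below one half when `m` is below the claimed bound. A randomized player wins with
probability at least one half only if this holds for some value of the seed.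
-/

noncomputable section

namespace HintGame

/-! ### The infimum-convolution inequality on the hypercube -/

/-- The infimum convolution of `f` with the quadratic cost `|x|² / 8`. -/
def infConv {d : ℕ} (f : (Fin d → ℝ) → ℝ) (x : Fin d → ℝ) : ℝ :=
  ⨅ y, (f y + (∑ i, (x i - y i) ^ 2) / 8)

/-- A point of the hypercube `{±1}^d`, seen as a tuple of real numbers. -/
def signTuple {d : ℕ} (h : Fin d → ℤˣ) : Fin d → ℝ := fun j => ((h j : ℤ) : ℝ)

lemma bddBelow_infConv {d : ℕ} {f : (Fin d → ℝ) → ℝ} (hf : ∀ x, 0 ≤ f x) (x : Fin d → ℝ) :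
    BddBelow (range fun y => f y + (∑ i, (x i - y i) ^ 2) / 8) := by
  refine ⟨0, ?_⟩
  rintro _ ⟨y, rfl⟩
  have := hf y
  positivity

lemma infConv_le {d : ℕ} {f : (Fin d → ℝ) → ℝ} (hf : ∀ x, 0 ≤ f x) (x y : Fin d → ℝ) :
    infConv f x ≤ f y + (∑ i, (x i - y i) ^ 2) / 8 :=
  ciInf_le (bddBelow_infConv hf x) y

lemma infConv_cons_le_self {d : ℕ} {f : (Fin (d + 1) → ℝ) → ℝ} (hf : ∀ x, 0 ≤ f x) (s : ℝ)
    (x : Fin d → ℝ) :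
    infConv f (Fin.cons s x) ≤ infConv (fun y => f (Fin.cons s y)) x := by
  refine le_ciInf fun y => ?_
  refine (infConv_le hf _ (Fin.cons s y)).trans (le_of_eq ?_)
  simp [Fin.sum_univ_succ]

/-- The infimum convolution at a point of one facet of the cube is controlled by an interpolation
between the two facets, at the cost of a quadratic term. -/
lemma infConv_cons_le_interpolate {d : ℕ} {f : (Fin (d + 1) → ℝ) → ℝ} (hf : ∀ x, 0 ≤ f x)
    (hc : ConvexOn ℝ univ f) (s t : ℝ) (hst : (s - t) ^ 2 = 4) (x : Fin d → ℝ) (r : ℝ)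
    (hr0 : 0 ≤ r) (hr1 : r ≤ 1) :
    infConv f (Fin.cons s x) ≤ r * infConv (fun y => f (Fin.cons s y)) x
      + (1 - r) * infConv (fun y => f (Fin.cons t y)) x + (1 - r) ^ 2 / 2 := by
  rw [← sub_le_iff_le_add]
  unfold infConv
  rw [Real.mul_iInf_of_nonneg hr0, Real.mul_iInf_of_nonneg (by linarith)]
  refine le_ciInf_add_ciInf fun y z => ?_
  rw [sub_le_iff_le_add]
  refine (infConv_le hf _ (r • Fin.cons s y + (1 - r) • Fin.cons t z)).trans ?_
  have h1 := hc.2 (mem_univ (Fin.cons s y : Fin (d + 1) → ℝ))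
    (mem_univ (Fin.cons t z : Fin (d + 1) → ℝ)) hr0 (by linarith : 0 ≤ 1 - r) (by ring)
  simp only [smul_eq_mul] at h1
  have h2 : ∑ i, (x i - (r * y i + (1 - r) * z i)) ^ 2
      ≤ r * ∑ i, (x i - y i) ^ 2 + (1 - r) * ∑ i, (x i - z i) ^ 2 := by
    rw [Finset.mul_sum, Finset.mul_sum, ← Finset.sum_add_distrib]
    refine Finset.sum_le_sum fun i _ => ?_
    nlinarith [mul_nonneg (mul_nonneg hr0 (by linarith : 0 ≤ 1 - r)) (sq_nonneg (y i - z i))]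
  have h3 : (s - (r * s + (1 - r) * t)) ^ 2 = 4 * (1 - r) ^ 2 := by
    rw [← hst]; ring
  simp only [Fin.sum_univ_succ, Pi.add_apply, Pi.smul_apply, Fin.cons_zero, Fin.cons_succ,
    smul_eq_mul, h3]
  linarith

lemma exp_one_sub_le {r : ℝ} (hr0 : 0 ≤ r) (hr1 : r ≤ 1) :
    Real.exp (1 - r) ≤ (3 - r) / (1 + r) := by
  have h := Real.exp_bound' (x := 1 - r) (by linarith) (by linarith) (n := 3) (by norm_num)
  refine h.trans ?_
  rw [le_div_iff₀ (by linarith)]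
  simp [Finset.sum_range_succ, Nat.factorial]
  have : 0 ≤ 1 - r := by linarith
  nlinarith [pow_nonneg this 3, pow_nonneg this 4]

/-- The two-point inequality behind the induction on the dimension of the cube. -/
lemma exp_two_point_le {r : ℝ} (hr0 : 0 < r) (hr1 : r ≤ 1) :
    Real.exp ((1 - r) ^ 2 / 2 - r * Real.log r) ≤ (3 - r) / (1 + r) := by
  refine le_trans (Real.exp_le_exp.2 ?_) (exp_one_sub_le hr0.le hr1)
  have h1 : -Real.log r ≤ Real.sinh (-Real.log r) :=
    Real.self_le_sinh_iff.2 (by have := Real.log_nonpos hr0.le hr1; linarith)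
  rw [Real.sinh_neg, Real.sinh_log hr0] at h1
  have h2 : r * (-Real.log r) ≤ r * (-((r - r⁻¹) / 2)) := mul_le_mul_of_nonneg_left h1 hr0.le
  have h3 : r * (-((r - r⁻¹) / 2)) = (1 - r ^ 2) / 2 := by field_simp; ring
  nlinarith

/-- Hölder's inequality for finite sums of exponentials. -/
lemma sum_exp_interpolate_le {ι : Type*} [Fintype ι] [Nonempty ι] (a b : ι → ℝ) {r : ℝ}
    (hr0 : 0 ≤ r) (hr1 : r ≤ 1) :
    ∑ i, Real.exp (r * a i + (1 - r) * b i)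
      ≤ Real.exp (r * Real.log (∑ i, Real.exp (a i))
          + (1 - r) * Real.log (∑ i, Real.exp (b i))) := by
  have hA : 0 < ∑ i, Real.exp (a i) :=
    Finset.sum_pos (fun i _ => Real.exp_pos _) Finset.univ_nonempty
  have hB : 0 < ∑ i, Real.exp (b i) :=
    Finset.sum_pos (fun i _ => Real.exp_pos _) Finset.univ_nonempty
  set A := ∑ i, Real.exp (a i)
  set B := ∑ i, Real.exp (b i)
  have key : ∀ i, Real.exp (r * a i + (1 - r) * b i)
      ≤ Real.exp (r * Real.log A + (1 - r) * Real.log B)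
        * (r * (Real.exp (a i) / A) + (1 - r) * (Real.exp (b i) / B)) := by
    intro i
    have h := convexOn_exp.2 (mem_univ (a i - Real.log A)) (mem_univ (b i - Real.log B)) hr0
      (by linarith : 0 ≤ 1 - r) (by ring)
    simp only [smul_eq_mul, Real.exp_sub, Real.exp_log hA, Real.exp_log hB] at h
    calc Real.exp (r * a i + (1 - r) * b i)
        = Real.exp (r * Real.log A + (1 - r) * Real.log B)
          * Real.exp (r * (a i - Real.log A) + (1 - r) * (b i - Real.log B)) := by
          rw [← Real.exp_add]; ring_nf
      _ ≤ _ := mul_le_mul_of_nonneg_left h (Real.exp_pos _).le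
  refine (Finset.sum_le_sum fun i _ => key i).trans (le_of_eq ?_)
  rw [← Finset.mul_sum, Finset.sum_add_distrib, ← Finset.mul_sum, ← Finset.mul_sum,
    ← Finset.sum_div, ← Finset.sum_div, div_self hA.ne', div_self hB.ne']
  ring

lemma sum_cube_succ {d : ℕ} (F : (Fin (d + 1) → ℤˣ) → ℝ) (s : ℤˣ) :
    ∑ h, F h = ∑ h, F (Fin.cons s h) + ∑ h, F (Fin.cons (-s) h) := by
  rw [← (Fin.consEquiv fun _ : Fin (d + 1) => ℤˣ).sum_comp, Fintype.sum_prod_type]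
  have : (Finset.univ : Finset ℤˣ) = {s, -s} := by
    rcases Int.units_eq_one_or s with rfl | rfl <;> decide
  rw [this, Finset.sum_pair]
  · rfl
  · rcases Int.units_eq_one_or s with rfl | rfl <;> decide

lemma signTuple_cons {d : ℕ} (s : ℤˣ) (h : Fin d → ℤˣ) :
    signTuple (Fin.cons s h : Fin (d + 1) → ℤˣ) = Fin.cons ((s : ℤ) : ℝ) (signTuple h) := by
  funext j
  refine Fin.cases ?_ (fun j => ?_) j <;> simp [signTuple]

/-- The infimum-convolution inequality on the hypercube: for a nonnegative convex `f`, the averages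
of `exp (infConv f)` and of `exp (-f)` over the cube have product at most one. -/
theorem sum_exp_infConv_mul_le (d : ℕ) (f : (Fin d → ℝ) → ℝ) (hf : ∀ x, 0 ≤ f x)
    (hc : ConvexOn ℝ univ f) :
    (∑ h : Fin d → ℤˣ, Real.exp (infConv f (signTuple h)))
      * ∑ h : Fin d → ℤˣ, Real.exp (-f (signTuple h)) ≤ 4 ^ d := by
  induction d with
  | zero =>
    rw [Fintype.sum_subsingleton _ (fun i => i.elim0 : Fin 0 → ℤˣ),
      Fintype.sum_subsingleton _ (fun i => i.elim0 : Fin 0 → ℤˣ), ← Real.exp_add]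
    generalize signTuple (fun i => i.elim0 : Fin 0 → ℤˣ) = x
    have := infConv_le hf x x
    simp at this ⊢
    linarith
  | succ d ih =>
    have slice : ∀ s : ℝ, ConvexOn ℝ univ fun y : Fin d → ℝ => f (Fin.cons s y) := by
      intro s
      refine ⟨convex_univ, fun x _ y _ a b ha hb hab => ?_⟩
      have h := hc.2 (mem_univ (Fin.cons s x : Fin (d + 1) → ℝ))
        (mem_univ (Fin.cons s y : Fin (d + 1) → ℝ)) ha hb hab
      have e : (Fin.cons s (a • x + b • y) : Fin (d + 1) → ℝ)
          = a • (Fin.cons s x : Fin (d + 1) → ℝ) + b • (Fin.cons s y : Fin (d + 1) → ℝ) := by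
        funext j
        refine Fin.cases ?_ (fun j => ?_) j
        · simp [← add_mul, hab]
        · simp
      simpa only [e] using h
    set p : ℤˣ → ℝ := fun s => ∑ h : Fin d → ℤˣ,
      Real.exp (-f (Fin.cons ((s : ℤ) : ℝ) (signTuple h)))
      with hp
    set G : ℤˣ → ℝ := fun s => ∑ h : Fin d → ℤˣ,
      Real.exp (infConv (fun y => f (Fin.cons ((s : ℤ) : ℝ) y)) (signTuple h)) with hG
    have hp0 : ∀ s, 0 < p s := fun s =>
      Finset.sum_pos (fun i _ => Real.exp_pos _) Finset.univ_nonempty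
    have hG0 : ∀ s, 0 < G s := fun s =>
      Finset.sum_pos (fun i _ => Real.exp_pos _) Finset.univ_nonempty
    have hI : ∀ s, G s ≤ 4 ^ d / p s := fun s => by
      rw [le_div_iff₀ (hp0 s)]
      exact ih _ (fun x => hf _) (slice _)
    -- the facet with the larger average of `exp (-f)` is the one to interpolate towards
    have main : ∀ s : ℤˣ, p (-s) ≤ p s →
        (∑ h : Fin (d + 1) → ℤˣ, Real.exp (infConv f (signTuple h)))
          * ∑ h : Fin (d + 1) → ℤˣ, Real.exp (-f (signTuple h)) ≤ 4 ^ (d + 1) := by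
      intro s hs
      rw [sum_cube_succ _ s, sum_cube_succ (fun h => Real.exp (-f (signTuple h))) s]
      simp only [signTuple_cons]
      change (_ + _) * (p s + p (-s)) ≤ _
      have hsq : ((((-s : ℤˣ) : ℤ) : ℝ) - ((s : ℤ) : ℝ)) ^ 2 = 4 := by
        rcases Int.units_eq_one_or s with rfl | rfl <;> norm_num
      set r := p (-s) / p s with hr
      have hr0 : 0 < r := div_pos (hp0 _) (hp0 _)
      have hr1 : r ≤ 1 := (div_le_one (hp0 _)).2 hs
      have e1 : ∑ h : Fin d → ℤˣ, Real.exp (infConv f (Fin.cons ((s : ℤ) : ℝ) (signTuple h)))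
          ≤ 4 ^ d / p s :=
        (Finset.sum_le_sum fun h _ => Real.exp_le_exp.2 (infConv_cons_le_self hf _ _)).trans (hI s)
      have e2 : ∑ h : Fin d → ℤˣ,
          Real.exp (infConv f (Fin.cons (((-s : ℤˣ) : ℤ) : ℝ) (signTuple h)))
          ≤ 4 ^ d / p s * ((3 - r) / (1 + r)) := by
        calc _ ≤ ∑ h : Fin d → ℤˣ, Real.exp ((1 - r) ^ 2 / 2) * Real.exp (
                r * infConv (fun y => f (Fin.cons (((-s : ℤˣ) : ℤ) : ℝ) y)) (signTuple h)
                + (1 - r) * infConv (fun y => f (Fin.cons ((s : ℤ) : ℝ) y)) (signTuple h)) := by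
              refine Finset.sum_le_sum fun h _ => ?_
              rw [← Real.exp_add, Real.exp_le_exp]
              have := infConv_cons_le_interpolate hf hc _ _ hsq (signTuple h) r hr0.le hr1
              linarith
          _ ≤ Real.exp ((1 - r) ^ 2 / 2) * Real.exp (r * Real.log (G (-s))
                + (1 - r) * Real.log (G s)) := by
              rw [← Finset.mul_sum]
              exact mul_le_mul_of_nonneg_left (sum_exp_interpolate_le _ _ hr0.le hr1)
                (Real.exp_pos _).le
          _ ≤ Real.exp ((1 - r) ^ 2 / 2) * Real.exp (r * Real.log (4 ^ d / p (-s))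
                + (1 - r) * Real.log (4 ^ d / p s)) := by
              have := Real.log_le_log (hG0 (-s)) (hI (-s))
              have := Real.log_le_log (hG0 s) (hI s)
              have : 0 ≤ 1 - r := by linarith
              gcongr
          _ = 4 ^ d / p s * Real.exp ((1 - r) ^ 2 / 2 - r * Real.log r) := by
              have h4 : (4 : ℝ) ^ d ≠ 0 := by positivity
              have hx : 0 < 4 ^ d / p s := div_pos (by positivity) (hp0 s)
              have hlr : Real.log r = Real.log (p (-s)) - Real.log (p s) :=
                Real.log_div (hp0 _).ne' (hp0 _).ne'
              conv_rhs => rw [← Real.exp_log hx]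
              rw [← Real.exp_add, ← Real.exp_add, hlr, Real.log_div h4 (hp0 _).ne',
                Real.log_div h4 (hp0 _).ne']
              ring_nf
          _ ≤ _ := mul_le_mul_of_nonneg_left (exp_two_point_le hr0 hr1)
              (div_nonneg (by positivity) (hp0 s).le)
      have hps := hp0 s
      calc _ ≤ (4 ^ d / p s + 4 ^ d / p s * ((3 - r) / (1 + r))) * (p s + p (-s)) := by
            have := hp0 (-s)
            gcongr
        _ = (4 ^ d / p s + 4 ^ d / p s * ((3 - r) / (1 + r))) * (p s * (1 + r)) := by
            rw [hr]; field_simp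
        _ = 4 ^ (d + 1) := by
            have : 1 + r ≠ 0 := by linarith
            rw [pow_succ]; field_simp; ring
    rcases le_total (p (-1)) (p 1) with h | h
    · exact main 1 h
    · exact main (-1) (by rw [neg_neg]; exact h)

/-! ### An admissible hypercube constant -/

lemma sum_cube_linear_sq (d : ℕ) (w : Fin d → ℝ) :
    ∑ h : Fin d → ℤˣ, (∑ j, w j * ((h j : ℤ) : ℝ)) ^ 2 = 2 ^ d * ∑ j, w j ^ 2 := by
  induction d with
  | zero => simp
  | succ d ih =>
    rw [sum_cube_succ _ 1, ← Finset.sum_add_distrib]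
    simp only [Fin.sum_univ_succ, Fin.cons_zero, Fin.cons_succ]
    have : ∀ h : Fin d → ℤˣ, (w 0 * (((1 : ℤˣ) : ℤ) : ℝ) + ∑ j, w j.succ * ((h j : ℤ) : ℝ)) ^ 2
        + (w 0 * (((-1 : ℤˣ) : ℤ) : ℝ) + ∑ j, w j.succ * ((h j : ℤ) : ℝ)) ^ 2
        = 2 * w 0 ^ 2 + 2 * (∑ j, w j.succ * ((h j : ℤ) : ℝ)) ^ 2 := fun h => by
      push_cast; ring
    rw [Finset.sum_congr rfl fun h _ => this h, Finset.sum_add_distrib, ← Finset.mul_sum,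
      ← Finset.mul_sum, ih fun j => w j.succ]
    simp
    ring

/-- `1/32` is an admissible hypercube constant: the infimum-convolution inequality is applied to
`|Zᵀx|² / 8`, whose infimum convolution is at least `|Zᵀx|² / 16` by Bessel's inequality. -/
theorem isHypercubeConstant_one_div : IsHypercubeConstant (1 / 32) := by
  classical
  refine ⟨by norm_num, fun d k z hz t ht0 ht => ?_⟩
  set Q : (Fin d → ℝ) → ℝ := fun x => ∑ i, ⟪z i, WithLp.toLp 2 x⟫ ^ 2 with hQ
  have hQ0 : ∀ x, 0 ≤ Q x := fun x => Finset.sum_nonneg fun i _ => sq_nonneg _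
  have hconv : ConvexOn ℝ univ fun x => Q x / 8 := by
    refine ⟨convex_univ, fun x _ y _ a b ha hb hab => ?_⟩
    have : Q (a • x + b • y) ≤ a * Q x + b * Q y := by
      simp only [hQ, Finset.mul_sum, ← Finset.sum_add_distrib, WithLp.toLp_add, WithLp.toLp_smul,
        inner_add_right, inner_smul_right]
      refine Finset.sum_le_sum fun i _ => ?_
      obtain rfl : b = 1 - a := by linarith
      nlinarith [mul_nonneg (mul_nonneg ha hb)
        (sq_nonneg (⟪z i, WithLp.toLp 2 x⟫ - ⟪z i, WithLp.toLp 2 y⟫))]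
    simp only [smul_eq_mul]
    linarith
  have hinf : ∀ x, Q x / 16 ≤ infConv (fun x => Q x / 8) x := by
    intro x
    refine le_ciInf fun y => ?_
    have hB := hz.sum_inner_products_le (WithLp.toLp 2 (x - y) : Vec d) (s := Finset.univ)
    rw [EuclideanSpace.norm_sq_eq] at hB
    simp only [Real.norm_eq_abs, sq_abs, Pi.sub_apply, WithLp.toLp_sub, inner_sub_right] at hB
    have : Q x / 16 ≤ Q y / 8
        + (∑ i, (⟪z i, WithLp.toLp 2 x⟫ - ⟪z i, WithLp.toLp 2 y⟫) ^ 2) / 8 := by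
      simp only [hQ, Finset.sum_div, ← Finset.sum_add_distrib]
      refine Finset.sum_le_sum fun i _ => ?_
      nlinarith [sq_nonneg (⟪z i, WithLp.toLp 2 x⟫ - 2 * ⟪z i, WithLp.toLp 2 y⟫)]
    linarith
  have hcard : (Fintype.card (Fin d → ℤˣ) : ℝ) = 2 ^ d := by simp
  have hsum : ∑ h : Fin d → ℤˣ, Q (signTuple h) = 2 ^ d * k := by
    rw [Finset.sum_comm]
    have : ∀ i, ∑ h : Fin d → ℤˣ, ⟪z i, WithLp.toLp 2 (signTuple h)⟫ ^ 2 = 2 ^ d := by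
      intro i
      have h1 := sum_cube_linear_sq d fun j => z i j
      have h2 : ∑ j, z i j ^ 2 = 1 := by
        have := EuclideanSpace.norm_sq_eq (z i)
        rw [hz.1 i] at this
        simpa using this.symm
      rw [h2, mul_one] at h1
      rw [← h1]
      refine Finset.sum_congr rfl fun h _ => ?_
      simp [PiLp.inner_apply, signTuple, mul_comm]
    rw [Finset.sum_congr rfl fun i _ => this i]
    simp [mul_comm]
  -- Jensen's inequality, through the tangent line of `exp` at the mean
  have hJ : 2 ^ d * Real.exp (k / 16)
      ≤ ∑ h : Fin d → ℤˣ, Real.exp (infConv (fun x => Q x / 8) (signTuple h)) := by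
    calc 2 ^ d * Real.exp (k / 16)
        = ∑ h : Fin d → ℤˣ, Real.exp (k / 16) * (Q (signTuple h) / 16 - k / 16 + 1) := by
          rw [← Finset.mul_sum, Finset.sum_add_distrib, Finset.sum_sub_distrib, ← Finset.sum_div,
            hsum]
          simp only [Finset.sum_const, Finset.card_univ, nsmul_eq_mul, hcard]
          ring
      _ ≤ _ := Finset.sum_le_sum fun h _ => by
          refine le_trans ?_ (Real.exp_le_exp.2 (hinf _))
          calc _ ≤ Real.exp (k / 16) * Real.exp (Q (signTuple h) / 16 - k / 16) :=
                mul_le_mul_of_nonneg_left (Real.add_one_le_exp _) (Real.exp_pos _).le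
            _ = _ := by rw [← Real.exp_add]; ring_nf
  set B := Finset.univ.filter fun h : Fin d → ℤˣ => ∀ i, |⟪z i, signVec h⟫| ≤ t with hBdef
  have hlow : (B.card : ℝ) * Real.exp (-(k / 32))
      ≤ ∑ h : Fin d → ℤˣ, Real.exp (-(Q (signTuple h) / 8)) := by
    calc (B.card : ℝ) * Real.exp (-(k / 32)) = ∑ h ∈ B, Real.exp (-(k / 32 : ℝ)) := by simp
      _ ≤ ∑ h ∈ B, Real.exp (-(Q (signTuple h) / 8)) := by
          refine Finset.sum_le_sum fun h hh => Real.exp_le_exp.2 ?_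
          have hh' := (Finset.mem_filter.1 hh).2
          have : Q (signTuple h) ≤ ∑ _i : Fin k, (1 / 4 : ℝ) := by
            refine Finset.sum_le_sum fun i _ => ?_
            have h1 : |⟪z i, WithLp.toLp 2 (signTuple h)⟫| ≤ 1 / 2 := (hh' i).trans ht
            rw [← sq_abs]
            nlinarith [abs_nonneg ⟪z i, WithLp.toLp 2 (signTuple h)⟫]
          simp at this
          linarith
      _ ≤ _ := Finset.sum_le_sum_of_subset_of_nonneg (Finset.subset_univ _)
          fun _ _ _ => (Real.exp_pos _).le
  have key := sum_exp_infConv_mul_le d (fun x => Q x / 8)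
    (fun x => div_nonneg (hQ0 x) (by norm_num)) hconv
  have h1 : 2 ^ d * Real.exp (k / 16) * ((B.card : ℝ) * Real.exp (-(k / 32))) ≤ 4 ^ d :=
    (mul_le_mul hJ hlow (by positivity) (Finset.sum_nonneg fun _ _ => (Real.exp_pos _).le)).trans
      key
  have h2 : (B.card : ℝ) / 2 ^ d ≤ Real.exp (-(k / 32)) := by
    rw [div_le_iff₀ (by positivity), Real.exp_neg, ← div_eq_inv_mul, le_div_iff₀ (Real.exp_pos _)]
    have h4 : (4 : ℝ) ^ d = 2 ^ d * 2 ^ d := by rw [← mul_pow]; norm_num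
    have h5 : Real.exp ((k : ℝ) / 16) * Real.exp (-(k / 32)) = Real.exp (k / 32) := by
      rw [← Real.exp_add]; ring_nf
    rw [h4] at h1
    have h6 : 2 ^ d * ((B.card : ℝ) * Real.exp (k / 32)) ≤ 2 ^ d * 2 ^ d := by
      rw [← h5]; linarith
    exact le_of_mul_le_mul_left h6 (by positivity)
  refine h2.trans ?_
  rw [Real.rpow_def_of_pos two_pos, Real.exp_le_exp]
  have hl : Real.log 2 ≤ 1 := by have := Real.log_two_lt_d9; linarith
  have hk : (0 : ℝ) ≤ k / 32 := by positivity
  nlinarith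

/-- An admissible hypercube constant is at most `2`, as the vector `(1, 1) / √2` is orthogonal
to one of the four points of the square. -/
lemma IsHypercubeConstant.le_two {c : ℝ} (hc : IsHypercubeConstant c) : c ≤ 2 := by
  classical
  set u : Vec 2 := WithLp.toLp 2 fun _ => (Real.sqrt 2)⁻¹ with hu
  have hz : Orthonormal ℝ fun _ : Fin 1 => u := by
    refine ⟨fun i => ?_, fun i j hij => absurd (Subsingleton.elim i j) hij⟩
    rw [← sq_eq_sq₀ (norm_nonneg _) zero_le_one, EuclideanSpace.norm_sq_eq]
    simp [hu]
  have h := hc.2 2 1 _ hz (1 / 2) (by norm_num) le_rfl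
  have hmem : (fun j => if j = 0 then 1 else -1 : Fin 2 → ℤˣ) ∈ Finset.univ.filter
      fun h : Fin 2 → ℤˣ => ∀ i : Fin 1, |⟪u, signVec h⟫| ≤ 1 / 2 := by
    simp [hu, signVec, PiLp.inner_apply]
  have hcard := Finset.card_pos.2 ⟨_, hmem⟩
  have h1 : (1 : ℝ) / 2 ^ 2 ≤ 2 ^ (-(c * (1 : ℕ))) := by
    refine le_trans ?_ h
    gcongr
    exact_mod_cast hcard
  by_contra hlt
  push Not at hlt
  have h2 : (2 : ℝ) ^ (-(c * (1 : ℕ))) < 2 ^ (-2 : ℝ) :=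
    Real.rpow_lt_rpow_of_exponent_lt one_lt_two (by push_cast; linarith)
  have h3 : (2 : ℝ) ^ (-2 : ℝ) = 1 / 2 ^ 2 := by
    rw [Real.rpow_neg two_pos.le]; norm_num
  exact absurd (h1.trans_lt (h2.trans_eq h3)) (lt_irrefl _)

/-! ### Orthonormal vectors from robustly independent ones -/

lemma gramSchmidt_eq_starProjection {E : Type*} [NormedAddCommGroup E] [InnerProductSpace ℝ E]
    [FiniteDimensional ℝ E] {k : ℕ} (y : Fin k → E) (i : Fin k) :
    InnerProductSpace.gramSchmidt ℝ y i
      = (Submodule.span ℝ (y '' Iio i))ᗮ.starProjection (y i) := by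
  have hdef := InnerProductSpace.gramSchmidt_def'' ℝ y i
  symm
  apply Submodule.eq_starProjection_of_mem_of_inner_eq_zero
  · rw [← InnerProductSpace.span_gramSchmidt_Iio ℝ y i, Submodule.mem_orthogonal]
    intro u hu
    induction hu using Submodule.span_induction with
    | mem u hu =>
      obtain ⟨j, hj, rfl⟩ := hu
      exact InnerProductSpace.gramSchmidt_orthogonal ℝ y (ne_of_lt hj)
    | zero => simp
    | add u v _ _ hu hv => rw [inner_add_left, hu, hv, add_zero]
    | smul a u _ hu => rw [inner_smul_left, hu, mul_zero]
  · intro w hw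
    have hs : y i - InnerProductSpace.gramSchmidt ℝ y i ∈ Submodule.span ℝ (y '' Iio i) := by
      nth_rewrite 1 [hdef]
      rw [add_sub_cancel_left, ← InnerProductSpace.span_gramSchmidt_Iio ℝ y i]
      refine Submodule.sum_mem _ fun j hj => Submodule.smul_mem _ _ (Submodule.subset_span ?_)
      exact mem_image_of_mem _ (by simpa using hj)
    exact (Submodule.mem_orthogonal _ _).1 hw _ hs

/-- The Gram determinant is the product of the squared lengths of the Gram-Schmidt vectors. -/
lemma det_gram_eq_prod_gramSchmidt {E : Type*} [NormedAddCommGroup E] [InnerProductSpace ℝ E]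
    {k : ℕ} (y : Fin k → E) :
    (Matrix.gram ℝ y).det = ∏ i, ‖InnerProductSpace.gramSchmidt ℝ y i‖ ^ 2 := by
  set b := InnerProductSpace.gramSchmidt ℝ y with hb
  set U : Matrix (Fin k) (Fin k) ℝ := Matrix.of fun i j =>
    if i = j then 1 else ⟪b i, y j⟫ / ‖b i‖ ^ 2 with hU
  have hy : ∀ j, y j = ∑ i, U i j • b i := by
    intro j
    rw [← Finset.add_sum_erase _ _ (Finset.mem_univ j)]
    nth_rewrite 1 [InnerProductSpace.gramSchmidt_def'' ℝ y j]
    congr 1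
    · simp [hU, hb]
    · refine Finset.sum_subset_zero_on_sdiff ?_ ?_ ?_
      · intro i hi
        simp at hi ⊢
        exact hi.ne
      · intro i hi
        have hij : j < i := by
          simp at hi
          exact lt_of_le_of_ne hi.2 (Ne.symm hi.1)
        have : ⟪b i, y j⟫ = 0 := InnerProductSpace.gramSchmidt_inv_triangular ℝ y hij
        simp [hU, this, hij.ne']
      · intro i hi
        have hij : i ≠ j := by simp at hi; exact hi.ne
        simp [hU, hij, hb]
  have hgram : Matrix.gram ℝ y = U.transpose * Matrix.diagonal (fun i => ‖b i‖ ^ 2) * U := by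
    ext a c
    rw [Matrix.gram_apply]
    conv_lhs => rw [hy a, hy c]
    simp only [sum_inner, inner_sum, inner_smul_left, inner_smul_right]
    rw [Matrix.mul_apply]
    refine Finset.sum_congr rfl fun i _ => ?_
    rw [Matrix.mul_diagonal, Finset.sum_eq_single i]
    · rw [real_inner_self_eq_norm_sq]; simp; ring
    · intro j _ hj
      have : ⟪b j, b i⟫ = 0 := InnerProductSpace.gramSchmidt_orthogonal ℝ y hj
      simp [this]
    · simp
  have htri : U.BlockTriangular id := by
    intro i j hij
    have hij' : j < i := hij
    have : ⟪b i, y j⟫ = 0 := InnerProductSpace.gramSchmidt_inv_triangular ℝ y hij'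
    simp [hU, this, hij'.ne']
  have hdet : U.det = 1 := by
    rw [Matrix.det_of_isUpperTriangular htri]
    simp [hU]
  rw [hgram, Matrix.det_mul, Matrix.det_mul, Matrix.det_transpose, hdet, Matrix.det_diagonal]
  simp

/-- If many unit vectors are robustly independent, a fifth of that number of orthonormal vectors can
be found in their span whose products with any vector are controlled by those of the given ones.
They are the normalized left singular vectors with a large singular value: the product of the
singular values is bounded below by the Gram determinant, so a fifth of them is large. -/
theorem exists_orthonormal_of_robust {d k : ℕ} (hk : k ≤ d) {β : ℝ} (hβ0 : 0 < β) (hβ1 : β ≤ 1)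
    (y : Fin k → Vec d) (hy : ∀ i, ‖y i‖ = 1)
    (hr : ∀ i, β ≤ ‖(Submodule.span ℝ (y '' Iio i))ᗮ.starProjection (y i)‖) :
    ∃ p : ℕ, (k : ℝ) / 5 ≤ p ∧ ∃ z : Fin p → Vec d, Orthonormal ℝ z ∧
      ∀ (a : Vec d) (α : ℝ), (∀ j, |⟪a, y j⟫| ≤ α) →
        ∀ i, |⟪z i, a⟫| ≤ α * (Real.sqrt d / β) ^ (5 / 4 : ℝ) := by
  classical
  set hG := Matrix.isHermitian_gram ℝ y
  set ev := hG.eigenvalues with hev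
  set v := hG.eigenvectorBasis with hv
  set w : Fin k → Vec d := fun i => ∑ j, v i j • y j with hw
  have hww : ∀ i j, ⟪w i, w j⟫ = ev j * ⟪v i, v j⟫ := by
    intro i j
    have h1 := Matrix.star_dotProduct_gram_mulVec (𝕜 := ℝ) y (v i) (v j)
    rw [hG.mulVec_eigenvectorBasis j] at h1
    rw [hw]
    simp only
    rw [← h1]
    simp [dotProduct, PiLp.inner_apply, Finset.mul_sum, hev, hv]
    refine Finset.sum_congr rfl fun l _ => by ring
  have hdet : ∏ i, ev i = ∏ i, ‖InnerProductSpace.gramSchmidt ℝ y i‖ ^ 2 := by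
    rw [← det_gram_eq_prod_gramSchmidt, hG.det_eq_prod_eigenvalues]; rfl
  have hdetlow : β ^ (2 * k) ≤ ∏ i, ev i := by
    rw [hdet]
    calc β ^ (2 * k) = ∏ _i : Fin k, β ^ 2 := by simp [pow_mul]
      _ ≤ _ := Finset.prod_le_prod (fun _ _ => by positivity) fun i _ => by
          rw [gramSchmidt_eq_starProjection]
          exact pow_le_pow_left₀ hβ0.le (hr i) 2
  have hev0 : ∀ i, 0 < ev i := by
    intro i
    refine lt_of_le_of_ne ((Matrix.posSemidef_gram ℝ y).eigenvalues_nonneg i) fun h => ?_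
    have : ∏ i, ev i = 0 := Finset.prod_eq_zero (Finset.mem_univ i) h.symm
    have : 0 < β ^ (2 * k) := by positivity
    linarith
  have hevd : ∀ i, ev i ≤ d := by
    intro i
    have htr : ∑ i, ev i = k := by
      have h1 := hG.trace_eq_sum_eigenvalues
      simp [Matrix.trace, hy] at h1
      exact h1.symm
    calc ev i ≤ ∑ i, ev i := Finset.single_le_sum (fun i _ => (hev0 i).le) (Finset.mem_univ i)
      _ ≤ d := by rw [htr]; exact_mod_cast hk
  -- `θ` is the square of the threshold for the singular values
  set θ : ℝ := β ^ (5 / 2 : ℝ) * (d : ℝ) ^ (-(1 / 4) : ℝ) with hθ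
  set S := Finset.univ.filter fun i => θ ≤ ev i with hS
  -- otherwise more than `4k/5` eigenvalues are below `θ`, the others are at most `d` by the trace,
  -- and their product is less than `β^(2k)`: this is what the exponents in `θ` are chosen for
  have hcard : (k : ℝ) / 5 ≤ S.card := by
    by_contra hlt
    push Not at hlt
    have hkpos : 0 < k := by
      have hS0 : (0 : ℝ) ≤ S.card := by positivity
      have : (0 : ℝ) < k := by linarith
      exact_mod_cast this
    have hd1 : (1 : ℝ) ≤ d := by exact_mod_cast hkpos.trans_le hk
    have hd0 : (0 : ℝ) < d := by linarith
    have hD : 0 ≤ Real.log d := Real.log_nonneg hd1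
    have hb : Real.log β ≤ 0 := Real.log_nonpos hβ0.le hβ1
    have hlogθ : Real.log θ = 5 / 2 * Real.log β - 1 / 4 * Real.log d := by
      rw [hθ, Real.log_mul (Real.rpow_pos_of_pos hβ0 _).ne' (Real.rpow_pos_of_pos hd0 _).ne',
        Real.log_rpow hβ0, Real.log_rpow hd0]
      ring
    have h1 : 2 * k * Real.log β ≤ ∑ i, Real.log (ev i) := by
      rw [← Real.log_prod fun i _ => (hev0 i).ne']
      have := Real.log_le_log (by positivity) hdetlow
      rwa [Real.log_pow, Nat.cast_mul, Nat.cast_two] at this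
    have hcc : ((Sᶜ).card : ℝ) = k - S.card := by
      rw [Finset.card_compl, Fintype.card_fin, Nat.cast_sub]
      simpa using Finset.card_le_univ S
    have h2 : ∑ i, Real.log (ev i) < S.card * Real.log d + (k - S.card) * Real.log θ := by
      rw [← Finset.sum_add_sum_compl S]
      refine add_lt_add_of_le_of_lt ?_ ?_
      · rw [← nsmul_eq_mul]
        exact Finset.sum_le_card_nsmul _ _ _ fun i _ => Real.log_le_log (hev0 i) (hevd i)
      · rw [← hcc, ← nsmul_eq_mul, ← Finset.sum_const]
        refine Finset.sum_lt_sum_of_nonempty ?_ fun i hi => ?_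
        · rw [← Finset.card_pos]
          have : (0 : ℝ) < (Sᶜ).card := by
            rw [hcc]; have : (0 : ℝ) < k := by exact_mod_cast hkpos
            linarith
          exact_mod_cast this
        · refine Real.log_lt_log (hev0 i) ?_
          simpa [hS] using hi
    rw [hlogθ] at h2
    nlinarith [mul_nonneg (by linarith : (0 : ℝ) ≤ k - 5 * S.card) hD,
      mul_nonneg (by linarith : (0 : ℝ) ≤ k - 5 * S.card) (neg_nonneg.2 hb)]
  refine ⟨S.card, hcard, fun i => (Real.sqrt (ev (S.equivFin.symm i)))⁻¹ • w (S.equivFin.symm i),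
    ?_, ?_⟩
  · rw [orthonormal_iff_ite]
    intro i j
    rw [inner_smul_left, inner_smul_right, hww, orthonormal_iff_ite.1 v.orthonormal]
    by_cases hij : i = j
    · subst hij
      simp only [if_true, mul_one]
      have h0 := hev0 (S.equivFin.symm i)
      have hsq := Real.mul_self_sqrt h0.le
      have hne : Real.sqrt (ev (S.equivFin.symm i)) ≠ 0 := (Real.sqrt_pos.2 h0).ne'
      simp
      field_simp
      nlinarith
    · have : (S.equivFin.symm i : Fin k) ≠ S.equivFin.symm j := fun h =>
        hij (S.equivFin.symm.injective (Subtype.ext h))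
      simp [hij, this]
  · intro a α ha i
    set l : Fin k := (S.equivFin.symm i).1 with hl
    have hlS : θ ≤ ev l := (Finset.mem_filter.1 (S.equivFin.symm i).2).2
    have hkpos : 0 < k := l.pos
    have hd0 : (0 : ℝ) < d := by exact_mod_cast hkpos.trans_le hk
    have hα : 0 ≤ α := (abs_nonneg _).trans (ha l)
    have hθ0 : 0 < θ := mul_pos (Real.rpow_pos_of_pos hβ0 _) (Real.rpow_pos_of_pos hd0 _)
    have hlen : ⟪w l, a⟫ ^ 2 ≤ d * α ^ 2 := by
      have h1 : ⟪w l, a⟫ = ∑ j, v l j * ⟪y j, a⟫ := by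
        simp [hw, sum_inner, inner_smul_left]
      have h2 : ∑ j, v l j ^ 2 = 1 := by
        have := EuclideanSpace.norm_sq_eq (v l)
        rw [v.orthonormal.1 l] at this
        simpa using this.symm
      have h3 : ∑ j, ⟪y j, a⟫ ^ 2 ≤ d * α ^ 2 := by
        calc ∑ j, ⟪y j, a⟫ ^ 2 ≤ ∑ _j : Fin k, α ^ 2 := Finset.sum_le_sum fun j _ => by
              rw [real_inner_comm, ← sq_abs]
              exact pow_le_pow_left₀ (abs_nonneg _) (ha j) 2
          _ = k * α ^ 2 := by simp
          _ ≤ d * α ^ 2 := by gcongr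
      rw [h1]
      calc _ ≤ (∑ j, v l j ^ 2) * ∑ j, ⟪y j, a⟫ ^ 2 := Finset.sum_mul_sq_le_sq_mul_sq _ _ _
        _ ≤ _ := by rw [h2, one_mul]; exact h3
    have hfac : ((Real.sqrt d / β) ^ (5 / 4 : ℝ)) ^ 2 = d / θ := by
      have e1 : ((Real.sqrt d / β) ^ (5 / 4 : ℝ)) ^ 2 = (Real.sqrt d / β) ^ (5 / 2 : ℝ) := by
        rw [← Real.rpow_natCast, ← Real.rpow_mul (by positivity)]; norm_num
      have e2 : (Real.sqrt d) ^ (5 / 2 : ℝ) = (d : ℝ) * (d : ℝ) ^ (1 / 4 : ℝ) := by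
        rw [Real.sqrt_eq_rpow, ← Real.rpow_mul hd0.le]
        nth_rewrite 2 [← Real.rpow_one (d : ℝ)]
        rw [← Real.rpow_add hd0]; norm_num
      rw [e1, Real.div_rpow (Real.sqrt_nonneg _) hβ0.le, e2, hθ, Real.rpow_neg hd0.le]
      have := (Real.rpow_pos_of_pos hd0 (1 / 4 : ℝ)).ne'
      have := (Real.rpow_pos_of_pos hβ0 (5 / 2 : ℝ)).ne'
      field_simp
    rw [← abs_of_nonneg (show 0 ≤ α * (Real.sqrt d / β) ^ (5 / 4 : ℝ) by positivity), ← sq_le_sq,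
      mul_pow, hfac, inner_smul_left, mul_pow]
    simp only [conj_trivial, inv_pow]
    rw [Real.sq_sqrt (hev0 l).le, ← div_eq_inv_mul]
    calc ⟪w l, a⟫ ^ 2 / ev l ≤ d * α ^ 2 / θ := by gcongr
      _ = _ := by ring

/-! ### The measure of the almost orthogonal part of the sphere -/

/-- The linear map that multiplies the `i`-th coordinate in the orthonormal basis `b` by `w i`. -/
def diagMap {d : ℕ} (b : OrthonormalBasis (Fin d) ℝ (Vec d)) (w : Fin d → ℝ) : Vec d →ₗ[ℝ] Vec d :=
  Matrix.toLin b.toBasis b.toBasis (Matrix.diagonal w)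

section diagMap

variable {d : ℕ} (b : OrthonormalBasis (Fin d) ℝ (Vec d)) (w : Fin d → ℝ)

lemma inner_diagMap (x : Vec d) (i : Fin d) : ⟪b i, diagMap b w x⟫ = w i * ⟪b i, x⟫ := by
  have h := LinearMap.toMatrix_mulVec_repr b.toBasis b.toBasis (diagMap b w) x
  rw [diagMap, LinearMap.toMatrix_toLin] at h
  have hi := congrFun h i
  rw [Matrix.mulVec_diagonal] at hi
  simp only [OrthonormalBasis.coe_toBasis_repr_apply, OrthonormalBasis.repr_apply_apply] at hi
  exact hi.symm

lemma volume_real_image_diagMap (s : Set (Vec d)) :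
    (volume : Measure (Vec d)).real (diagMap b w '' s) = |∏ i, w i| * volume.real s := by
  rw [measureReal_def, Measure.addHaar_image_linearMap, diagMap, LinearMap.det_toLin,
    Matrix.det_diagonal, ENNReal.toReal_mul, ENNReal.toReal_ofReal (abs_nonneg _), measureReal_def]

lemma norm_sq_eq_sum_inner_sq (x : Vec d) : ‖x‖ ^ 2 = ∑ i, ⟪b i, x⟫ ^ 2 := by
  rw [← b.sum_sq_norm_inner_right x]
  simp

lemma norm_diagMap_le (hw : ∀ i, |w i| ≤ 1) (x : Vec d) : ‖diagMap b w x‖ ≤ ‖x‖ := by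
  rw [← sq_le_sq₀ (norm_nonneg _) (norm_nonneg _), norm_sq_eq_sum_inner_sq b,
    norm_sq_eq_sum_inner_sq b]
  refine Finset.sum_le_sum fun i _ => ?_
  rw [inner_diagMap, mul_pow]
  have : w i ^ 2 ≤ 1 := (sq_le_one_iff_abs_le_one _).2 (hw i)
  nlinarith [sq_nonneg ⟪b i, x⟫]

end diagMap

/-- A slab of half-width `1 / (6 √d)` around a hyperplane occupies at most half of the unit ball:
stretched four times in the normal direction and shrunk by `1 - 1 / (2 d)` in the others, which
at least doubles the volume, its intersection with the ball still fits into the ball. -/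
lemma volume_thin_slab_le {d : ℕ} (b : OrthonormalBasis (Fin d) ℝ (Vec d)) (j : Fin d) :
    (volume : Measure (Vec d)).real
      (Metric.ball 0 1 ∩ {x | |⟪b j, x⟫| < (6 * Real.sqrt d)⁻¹})
        ≤ 1 / 2 * volume.real (Metric.ball (0 : Vec d) 1) := by
  have hd : (0 : ℝ) < d := by exact_mod_cast j.pos
  have hd1 : (1 : ℝ) ≤ d := by exact_mod_cast j.pos
  set ρ : ℝ := 1 - 1 / (2 * d) with hρ
  have hle : 1 / (2 * (d : ℝ)) ≤ 1 / 2 := by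
    rw [div_le_div_iff₀ (by positivity) two_pos]; linarith
  have hρ0 : 0 < ρ := by rw [hρ]; linarith
  set w : Fin d → ℝ := fun i => if i = j then 4 else ρ with hw
  have hprod : 2 ≤ |∏ i, w i| := by
    have : ∏ i, w i = 4 * ρ ^ (d - 1) := by
      rw [← Finset.mul_prod_erase _ _ (Finset.mem_univ j)]
      congr 1
      · simp [hw]
      · rw [Finset.prod_congr rfl fun i hi => show w i = ρ by
          simp [hw, (Finset.mem_erase.1 hi).1]]
        simp
    have hB := one_add_mul_le_pow (a := -(1 / (2 * (d : ℝ)))) (by linarith) (d - 1)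
    have hcast : ((d - 1 : ℕ) : ℝ) = d - 1 := by rw [Nat.cast_sub j.pos]; simp
    have : (1 : ℝ) / 2 ≤ ρ ^ (d - 1) := by
      have e : (1 + -(1 / (2 * (d : ℝ)))) = ρ := by rw [hρ]; ring
      rw [e] at hB
      refine le_trans ?_ hB
      rw [hcast]
      have : ((d : ℝ) - 1) * -(1 / (2 * d)) = -(1 / 2) + 1 / (2 * d) := by field_simp; ring
      have : 0 < 1 / (2 * (d : ℝ)) := by positivity
      linarith
    refine le_trans ?_ (le_abs_self _)
    linarith
  set s := Metric.ball (0 : Vec d) 1 ∩ {x | |⟪b j, x⟫| < (6 * Real.sqrt d)⁻¹} with hs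
  have hsub : diagMap b w '' s ⊆ Metric.ball 0 1 := by
    rintro _ ⟨x, ⟨hx1, hx2⟩, rfl⟩
    rw [mem_ball_zero_iff] at hx1 ⊢
    rw [← sq_lt_one_iff₀ (norm_nonneg _), norm_sq_eq_sum_inner_sq b] at hx1 ⊢
    rw [← Finset.add_sum_erase _ _ (Finset.mem_univ j)] at hx1 ⊢
    simp only [inner_diagMap]
    rw [Finset.sum_congr rfl fun i hi => show (w i * ⟪b i, x⟫) ^ 2 = ρ ^ 2 * ⟪b i, x⟫ ^ 2 by
      simp [hw, (Finset.mem_erase.1 hi).1, mul_pow], ← Finset.mul_sum]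
    have hwj : w j = 4 := by simp [hw]
    have hj : ⟪b j, x⟫ ^ 2 ≤ 1 / (36 * d) := by
      have h1 := pow_le_pow_left₀ (abs_nonneg ⟪b j, x⟫) (le_of_lt (mem_ofPred_eq ▸ hx2)) 2
      rw [sq_abs, inv_pow, mul_pow, Real.sq_sqrt hd.le] at h1
      norm_num at h1 ⊢
      linarith
    have hρ2 : ρ ^ 2 ≤ 1 - 3 / (4 * d) := by
      have e : ρ ^ 2 = 1 - 1 / d + 1 / (4 * d) * (1 / d) := by rw [hρ]; field_simp; ring
      have h1 : (1 : ℝ) / d ≤ 1 := by rw [div_le_one hd]; exact hd1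
      have h2 : 1 / (4 * (d : ℝ)) * (1 / d) ≤ 1 / (4 * d) * 1 := by gcongr
      have e3 : 1 / (4 * (d : ℝ)) = 1 / 4 * (1 / d) := by field_simp
      have e4 : 3 / (4 * (d : ℝ)) = 3 / 4 * (1 / d) := by field_simp
      rw [e, e4]
      rw [e3] at h2 ⊢
      linarith
    have hS : 0 ≤ ∑ i ∈ Finset.univ.erase j, ⟪b i, x⟫ ^ 2 :=
      Finset.sum_nonneg fun _ _ => sq_nonneg _
    have hS1 : ∑ i ∈ Finset.univ.erase j, ⟪b i, x⟫ ^ 2 ≤ 1 := by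
      nlinarith [sq_nonneg ⟪b j, x⟫]
    rw [hwj, mul_pow]
    have e5 : 1 / (36 * (d : ℝ)) = 1 / 36 * (1 / d) := by field_simp
    have e4 : 3 / (4 * (d : ℝ)) = 3 / 4 * (1 / d) := by field_simp
    have : 0 < 1 / (d : ℝ) := by positivity
    nlinarith
  have hmono : (volume : Measure (Vec d)).real (diagMap b w '' s)
      ≤ volume.real (Metric.ball (0 : Vec d) 1) :=
    measureReal_mono hsub measure_ball_lt_top.ne
  rw [volume_real_image_diagMap] at hmono
  have : 0 ≤ (volume : Measure (Vec d)).real s := measureReal_nonneg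
  nlinarith

lemma measurableSet_slab {d k : ℕ} (q : HintQuery d k) : MeasurableSet (slab q) := by
  rw [slab, ofPred_forall]
  refine MeasurableSet.iInter fun i => IsClosed.measurableSet ?_
  exact isClosed_le (by fun_prop) continuous_const

/-- Vectors that are orthonormal apart from some that vanish, such as normalized Gram-Schmidt
vectors, are the first vectors of an orthonormal basis once the vanishing ones are replaced. -/
lemma exists_orthonormalBasis_extending {d r : ℕ} (e : Fin r → Vec d)
    (he : Orthonormal ℝ fun i : {i // e i ≠ 0} => e i) :
    ∃ b : OrthonormalBasis (Fin d) ℝ (Vec d), ∀ (i : Fin r) (h : i.1 < d), e i ≠ 0 →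
      b ⟨i, h⟩ = e i := by
  classical
  set v : Fin d → Vec d := fun i => if h : i.1 < r then e ⟨i, h⟩ else 0 with hv
  have horth : Orthonormal ℝ ({i | v i ≠ 0}.domRestrict v) := by
    have hlt : ∀ i : {i | v i ≠ 0}, i.1.1 < r := fun i => by
      by_contra h
      exact i.2 (by simp [hv, h])
    have hval : ∀ i : {i | v i ≠ 0}, v i.1 = e ⟨i.1.1, hlt i⟩ := fun i => by simp [hv, hlt i]
    let f : {i | v i ≠ 0} → {i // e i ≠ 0} := fun i => ⟨⟨i.1.1, hlt i⟩, by
      have := i.2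
      rw [mem_ofPred_eq, hval i] at this
      exact this⟩
    have hf : Function.Injective f := fun i j hij => by
      have : i.1.1 = j.1.1 := by simpa [f] using hij
      exact Subtype.ext (Fin.ext this)
    convert he.comp f hf using 1
    funext i
    exact hval i
  obtain ⟨b, hb⟩ := horth.exists_orthonormalBasis_extension_of_card_eq (by simp)
  refine ⟨b, fun i h hi => ?_⟩
  have hvi : v ⟨i, h⟩ = e i := by simp [hv]
  rw [hb ⟨i, h⟩ (by rw [mem_ofPred_eq, hvi]; exact hi), hvi]

open scoped Pointwise in
/-- The proportion of the sphere that is almost orthogonal to the submitted vectors is at least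
`(12 d^(7/2))^(-k)`. The part of the ball away from a hyperplane that contains these vectors is
contracted in their directions, by a linear map, into the cone over the slab. -/
theorem surface_slab_ge {d k : ℕ} (hk : k < d) (q : HintQuery d k) :
    (surface d).real univ ≤ (12 * (d : ℝ) ^ 3 * Real.sqrt d) ^ k * (surface d).real (slab q) := by
  obtain ⟨r, x⟩ := q
  have hrk : r.1 ≤ k := Nat.lt_succ_iff.1 r.2
  have hd1 : (1 : ℝ) ≤ d := by exact_mod_cast (Nat.zero_le k).trans_lt hk
  have hd0 : (0 : ℝ) < d := by linarith
  have hsq1 : 1 ≤ Real.sqrt d := Real.one_le_sqrt.2 hd1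
  have hX1 : 1 ≤ 12 * (d : ℝ) ^ 3 * Real.sqrt d := by
    have : (1 : ℝ) ≤ (d : ℝ) ^ 3 := one_le_pow₀ hd1
    nlinarith
  rcases Nat.eq_zero_or_pos r.1 with hr0 | hrpos
  · have : slab (⟨r, x⟩ : HintQuery d k) = univ := by
      refine eq_univ_of_forall fun z i => ?_
      exact absurd i.2 (by simp only [hr0]; omega)
    rw [this]
    exact le_mul_of_one_le_left measureReal_nonneg (one_le_pow₀ hX1)
  obtain ⟨b, hb⟩ := exists_orthonormalBasis_extending _
    (InnerProductSpace.gramSchmidtNormed_orthonormal' (𝕜 := ℝ) x)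
  have hrd : r.1 < d := hrk.trans_lt hk
  set τ : ℝ := (6 * Real.sqrt d)⁻¹ with hτ
  have hτ0 : 0 < τ := by positivity
  have hτ1 : τ ≤ 1 := inv_le_one_of_one_le₀ (by linarith)
  set ε : ℝ := ((d : ℝ) ^ 3)⁻¹ * τ with hε
  have hε0 : 0 < ε := by positivity
  have hε1 : ε ≤ 1 := mul_le_one₀ (inv_le_one_of_one_le₀ (one_le_pow₀ hd1)) hτ0.le hτ1
  set w : Fin d → ℝ := fun i => if i.1 < r.1 then ε else 1 with hw
  have hw1 : ∀ i, |w i| ≤ 1 := by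
    intro i
    by_cases h : i.1 < r.1
    · simp [hw, h, abs_of_pos hε0, hε1]
    · simp [hw, h]
  have hprod : |∏ i, w i| = ε ^ r.1 := by
    have h1 : (Finset.univ.filter fun i : Fin d => i.1 < r.1).card = r.1 := by
      rw [Fin.card_filter_val_lt]; omega
    have h2 : ∏ i, w i = ε ^ r.1 := by
      rw [hw, Finset.prod_ite, Finset.prod_const, h1, Finset.prod_const_one, mul_one]
    rw [h2, abs_of_pos (pow_pos hε0 _)]
  set j : Fin d := ⟨r.1, hrd⟩ with hj
  set E := Metric.ball (0 : Vec d) 1 ∩ {x | τ ≤ |⟪b j, x⟫|} with hE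
  have hEvol : 1 / 2 * (volume : Measure (Vec d)).real (Metric.ball (0 : Vec d) 1)
      ≤ volume.real E := by
    have hsub : Metric.ball (0 : Vec d) 1
        ⊆ (Metric.ball (0 : Vec d) 1 ∩ {x | |⟪b j, x⟫| < τ}) ∪ E := fun y hy => by
      rcases lt_or_ge |⟪b j, y⟫| τ with h | h
      · exact Or.inl ⟨hy, h⟩
      · exact Or.inr ⟨hy, h⟩
    have h1 : (volume : Measure (Vec d)).real (Metric.ball (0 : Vec d) 1) ≤ _ :=
      measureReal_mono hsub (ne_top_of_le_ne_top
        (measure_ball_lt_top (x := (0 : Vec d)) (r := 1)).ne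
        (measure_mono (union_subset inter_subset_left inter_subset_left)))
    have h2 := h1.trans (measureReal_union_le _ _)
    have h3 := volume_thin_slab_le b j
    linarith
  have hcone : diagMap b w '' E
      ⊆ Ioo (0 : ℝ) 1 • (Subtype.val '' slab (⟨r, x⟩ : HintQuery d k)) := by
    rintro _ ⟨y, ⟨hy1, hy2⟩, rfl⟩
    rw [mem_ball_zero_iff] at hy1
    have hT1 : ‖diagMap b w y‖ < 1 := (norm_diagMap_le b w hw1 y).trans_lt hy1
    have hTτ : τ ≤ ‖diagMap b w y‖ := by
      have h1 := abs_real_inner_le_norm (b j) (diagMap b w y)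
      rw [inner_diagMap, b.orthonormal.1 j, one_mul] at h1
      have hwj : w j = 1 := by simp [hw, hj]
      rw [hwj, one_mul] at h1
      exact le_trans hy2 h1
    have hT0 : 0 < ‖diagMap b w y‖ := hτ0.trans_le hTτ
    refine Set.mem_smul.2 ⟨‖diagMap b w y‖, ⟨hT0, hT1⟩, (‖diagMap b w y‖)⁻¹ • diagMap b w y,
      ⟨⟨(‖diagMap b w y‖)⁻¹ • diagMap b w y, ?_⟩, ?_, rfl⟩, ?_⟩
    · rw [mem_sphere_zero_iff_norm, norm_smul, norm_inv, norm_norm, inv_mul_cancel₀ hT0.ne']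
    · intro i
      change |⟪InnerProductSpace.gramSchmidtNormed ℝ x i, (‖diagMap b w y‖)⁻¹ • diagMap b w y⟫| ≤ _
      by_cases hi : InnerProductSpace.gramSchmidtNormed ℝ x i = 0
      · rw [hi, inner_zero_left, abs_zero]; positivity
      · have hid : i.1 < d := i.2.trans hrd
        rw [← hb i hid hi, inner_smul_right, inner_diagMap, abs_mul, abs_mul,
          abs_of_pos (inv_pos.2 hT0)]
        have hwi : w ⟨i, hid⟩ = ε := by simp [hw]
        have h1 : |⟪b ⟨i, hid⟩, y⟫| ≤ 1 := by
          have h1 := abs_real_inner_le_norm (b ⟨i, hid⟩) y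
          rw [b.orthonormal.1, one_mul] at h1
          linarith
        rw [hwi, abs_of_pos hε0, inv_mul_le_iff₀ hT0]
        calc ε * |⟪b ⟨i, hid⟩, y⟫| ≤ ε * 1 := by gcongr
          _ = ((d : ℝ) ^ 3)⁻¹ * τ := by rw [mul_one]
          _ ≤ _ := by rw [mul_comm]; gcongr
    · rw [smul_smul, mul_inv_cancel₀ hT0.ne', one_smul]
  have hconeball : Ioo (0 : ℝ) 1 • (Subtype.val '' slab (⟨r, x⟩ : HintQuery d k))
      ⊆ Metric.ball (0 : Vec d) 1 := by
    rintro _ ⟨t, ht, _, ⟨z, _, rfl⟩, rfl⟩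
    simp [norm_smul, abs_of_pos ht.1, ht.2]
  have hvol : 1 / 2 * ε ^ r.1 * (volume : Measure (Vec d)).real (Metric.ball (0 : Vec d) 1)
      ≤ volume.real (Ioo (0 : ℝ) 1 • (Subtype.val '' slab (⟨r, x⟩ : HintQuery d k))) := by
    have h1 : (volume : Measure (Vec d)).real (diagMap b w '' E) ≤ _ :=
      measureReal_mono hcone
        (ne_top_of_le_ne_top measure_ball_lt_top.ne (measure_mono hconeball))
    rw [volume_real_image_diagMap, hprod] at h1
    refine le_trans ?_ h1
    have := mul_le_mul_of_nonneg_left hEvol (pow_pos hε0 r.1).le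
    linarith
  have hsurf : (surface d).real (slab (⟨r, x⟩ : HintQuery d k))
      = d * volume.real (Ioo (0 : ℝ) 1 • (Subtype.val '' slab (⟨r, x⟩ : HintQuery d k))) := by
    rw [measureReal_def, surface, Measure.toSphere_apply' _ (measurableSet_slab _),
      ENNReal.toReal_mul, measureReal_def]
    simp
  have huniv : (surface d).real univ = d * volume.real (Metric.ball (0 : Vec d) 1) := by
    rw [surface, Measure.toSphere_real_apply_univ]
    simp
  rw [hsurf, huniv]
  have hpow : 1 ≤ (12 * (d : ℝ) ^ 3 * Real.sqrt d) ^ k * (1 / 2 * ε ^ r.1) := by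
    have hX : 12 * (d : ℝ) ^ 3 * Real.sqrt d = 2 * ε⁻¹ := by
      rw [hε, hτ]; field_simp; norm_num
    calc (1 : ℝ) ≤ 2 ^ r.1 * (1 / 2) := by
          have : (2 : ℝ) ^ 1 ≤ 2 ^ r.1 := pow_le_pow_right₀ one_le_two hrpos
          linarith
      _ = (2 * ε⁻¹) ^ r.1 * (1 / 2 * ε ^ r.1) := by
          rw [mul_pow, inv_pow]
          have := (pow_pos hε0 r.1).ne'
          field_simp
      _ ≤ _ := by
          rw [← hX]
          gcongr
  have hB : 0 ≤ (volume : Measure (Vec d)).real (Metric.ball (0 : Vec d) 1) := measureReal_nonneg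
  set V := (volume : Measure (Vec d)).real (Metric.ball (0 : Vec d) 1)
  set X := (12 * (d : ℝ) ^ 3 * Real.sqrt d) ^ k with hXdef
  have hX0 : 0 ≤ X := by positivity
  calc d * V = d * (1 * V) := by ring
    _ ≤ d * ((X * (1 / 2 * ε ^ r.1)) * V) := by gcongr
    _ = X * (d * (1 / 2 * ε ^ r.1 * V)) := by ring
    _ ≤ _ := by gcongr

/-! ### The law of a hint -/

/-- A bound on the density of a hint with respect to the uniform law on the cells. -/
def hintDensity (d k : ℕ) : ℝ := (12 * (d : ℝ) ^ 3 * Real.sqrt d) ^ k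

lemma one_le_hintDensity {d k : ℕ} (hk : k < d) : 1 ≤ hintDensity d k := by
  have hd1 : (1 : ℝ) ≤ d := by exact_mod_cast (Nat.zero_le k).trans_lt hk
  refine one_le_pow₀ ?_
  have h1 := Real.one_le_sqrt.2 hd1
  have h2 : (1 : ℝ) ≤ (d : ℝ) ^ 3 := one_le_pow₀ hd1
  nlinarith

lemma log_hintDensity {d k : ℕ} (hk : k < d) :
    Real.log (hintDensity d k) = k * (Real.log 12 + 7 / 2 * Real.log d) := by
  have hd0 : (0 : ℝ) < d := by exact_mod_cast (Nat.zero_le k).trans_lt hk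
  rw [hintDensity, Real.log_pow, Real.log_mul (by positivity) (by positivity),
    Real.log_mul (by positivity) (by positivity), Real.log_pow, Real.log_sqrt hd0.le]
  push_cast
  ring

section hintProb

variable {d k : ℕ} {δ : ℝ} (D : SphereDiscretization d δ)

lemma SphereDiscretization.setOf_phi_eq_rep (i : Fin D.N) :
    {y | D.phi y = D.rep i} = D.index ⁻¹' {i} := by
  have h : ∀ j, D.index (D.rep j) = j := fun j => D.rep_mem j
  ext y
  constructor
  · intro hy
    have h1 := congrArg D.index (show D.rep (D.index y) = D.rep i from hy)
    rw [h, h] at h1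
    exact h1
  · intro hy
    exact congrArg D.rep (show D.index y = i from hy)

lemma SphereDiscretization.measurableSet_cell (i : Fin D.N) :
    MeasurableSet (D.index ⁻¹' {i}) := D.measurable_index (measurableSet_singleton i)

lemma surface_real_univ_pos (hd : 0 < d) : 0 < (surface d).real univ := by
  have : Nonempty (Fin d) := ⟨⟨0, hd⟩⟩
  rw [surface, Measure.toSphere_real_apply_univ]
  have h1 : 0 < (volume : Measure (Vec d)).real (Metric.ball 0 1) :=
    ENNReal.toReal_pos (Metric.measure_ball_pos _ _ one_pos).ne' measure_ball_lt_top.ne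
  have h2 : (0 : ℝ) < d := by exact_mod_cast hd
  simpa using mul_pos h2 h1

instance : IsFiniteMeasure (surface d) := by unfold surface; infer_instance

lemma surface_slab_pos (hk : k < d) (q : HintQuery d k) : 0 < (surface d).real (slab q) := by
  have h1 := surface_slab_ge hk q
  have h2 := surface_real_univ_pos ((Nat.zero_le k).trans_lt hk)
  by_contra h
  have h3 : (surface d).real (slab q) = 0 := le_antisymm (not_lt.1 h) measureReal_nonneg
  rw [h3, mul_zero] at h1
  linarith

lemma isProbabilityMeasure_oracleLaw (hk : k < d) (q : HintQuery d k) :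
    IsProbabilityMeasure (oracleLaw q) := by
  refine ProbabilityTheory.cond_isProbabilityMeasure fun h => ?_
  have := surface_slab_pos hk q
  rw [measureReal_def, h] at this
  simp at this

lemma hintProb_nonneg (q : HintQuery d k) (i : Fin D.N) : 0 ≤ hintProb D q i := measureReal_nonneg

lemma sum_hintProb (hk : k < d) (q : HintQuery d k) : ∑ i, hintProb D q i = 1 := by
  have := isProbabilityMeasure_oracleLaw hk q
  have h := sum_measureReal_preimage_singleton (μ := oracleLaw q) (Finset.univ : Finset (Fin D.N))
    (f := D.index) fun i _ => D.measurableSet_cell i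
  simp only [hintProb, D.setOf_phi_eq_rep]
  rw [h]
  simp

lemma surface_cell (i : Fin D.N) :
    (surface d).real (D.index ⁻¹' {i}) = (surface d).real univ / D.N := by
  have h := sum_measureReal_preimage_singleton (μ := surface d) (Finset.univ : Finset (Fin D.N))
    (f := D.index) fun i _ => D.measurableSet_cell i
  have hN : (D.N : ℝ) ≠ 0 := by exact_mod_cast i.pos.ne'
  rw [Finset.sum_congr rfl fun j _ => show (surface d).real (D.index ⁻¹' {j})
    = (surface d).real (D.index ⁻¹' {i}) by
      rw [measureReal_def, measureReal_def, D.equal_surface j i]] at h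
  rw [eq_div_iff hN, mul_comm]
  simpa using h

lemma hintProb_le (hk : k < d) (q : HintQuery d k) (i : Fin D.N) :
    hintProb D q i ≤ hintDensity d k / D.N := by
  have hslab := surface_slab_pos hk q
  have h1 : hintProb D q i
      = ((surface d).real (slab q))⁻¹ * (surface d).real (slab q ∩ D.index ⁻¹' {i}) := by
    rw [hintProb, D.setOf_phi_eq_rep, measureReal_def, oracleLaw,
      ProbabilityTheory.cond_apply (measurableSet_slab q), ENNReal.toReal_mul, ENNReal.toReal_inv]
    rfl
  have h2 : (surface d).real (slab q ∩ D.index ⁻¹' {i}) ≤ (surface d).real univ / D.N := by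
    rw [← surface_cell D i]
    exact measureReal_mono inter_subset_right
  rw [h1, inv_mul_le_iff₀ hslab]
  refine h2.trans ?_
  rw [mul_div_assoc', mul_comm]
  gcongr
  exact surface_slab_ge hk q

lemma SphereDiscretization.nonempty_cells (hd : 0 < d) : Nonempty (Fin D.N) := by
  have : Nonempty (Fin d) := ⟨⟨0, hd⟩⟩
  obtain ⟨x, hx⟩ := NormedSpace.sphere_nonempty (E := Vec d) (x := 0) (r := 1) |>.2 zero_le_one
  exact ⟨D.index ⟨x, hx⟩⟩

end hintProb

/-! ### Sequentially generated tuples -/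

/-- The probability of a tuple whose entries are drawn one after the other, the `l`-th one from
the law `p l` that depends on the previous ones. -/
def seqProb {T : Type*} {d : ℕ} (p : (l : Fin d) → (Fin l → T) → T → ℝ) (v : Fin d → T) : ℝ :=
  ∏ l : Fin d, p l (fun j => v (Fin.castLE l.isLt.le j)) (v l)

section seqProb

variable {T : Type*}

lemma seqProb_snoc {d : ℕ} (p : (l : Fin (d + 1)) → (Fin l → T) → T → ℝ) (v : Fin d → T) (x : T) :
    seqProb p (Fin.snoc v x : Fin (d + 1) → T)
      = seqProb (fun l : Fin d => p l.castSucc) v * p (Fin.last d) v x := by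
  rw [seqProb, Fin.prod_univ_castSucc]
  congr 1
  · refine Finset.prod_congr rfl fun l _ => ?_
    congr 1
    · funext j
      exact Fin.snoc_castSucc (α := fun _ => T) x v (Fin.castLE l.isLt.le j)
    · exact Fin.snoc_castSucc (α := fun _ => T) x v l
  · congr 1
    · funext j
      exact Fin.snoc_castSucc (α := fun _ => T) x v j
    · exact Fin.snoc_last (α := fun _ => T) x v

lemma seqProb_nonneg {d : ℕ} {p : (l : Fin d) → (Fin l → T) → T → ℝ} (hp0 : ∀ l h x, 0 ≤ p l h x)
    (v : Fin d → T) : 0 ≤ seqProb p v := Finset.prod_nonneg fun _ _ => hp0 _ _ _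

variable [Fintype T]

lemma sum_fin_succ_fun {d : ℕ} (F : (Fin (d + 1) → T) → ℝ) :
    ∑ v, F v = ∑ v : Fin d → T, ∑ x, F (Fin.snoc v x) := by
  rw [← (Fin.snocEquiv fun _ : Fin (d + 1) => T).sum_comp, Fintype.sum_prod_type, Finset.sum_comm]
  rfl

lemma sum_seqProb {d : ℕ} (p : (l : Fin d) → (Fin l → T) → T → ℝ)
    (hp1 : ∀ l h, ∑ x, p l h x = 1) : ∑ v, seqProb p v = 1 := by
  induction d with
  | zero => simp [seqProb]
  | succ d ih =>
    rw [sum_fin_succ_fun]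
    simp only [seqProb_snoc]
    rw [← ih (fun l : Fin d => p l.castSucc) fun l h => hp1 l.castSucc h]
    refine Finset.sum_congr rfl fun v _ => ?_
    rw [← Finset.mul_sum, hp1, mul_one]

/-- If every conditional law has density at most `L` with respect to the uniform law, then the
marginal law of the entries in `J` has density at most `L ^ #J`. -/
lemma sum_mul_seqProb_le [Nonempty T] {L : ℝ} {d : ℕ}
    (p : (l : Fin d) → (Fin l → T) → T → ℝ) (hp0 : ∀ l h x, 0 ≤ p l h x)
    (hp1 : ∀ l h, ∑ x, p l h x = 1) (hpL : ∀ l h x, p l h x ≤ L / Fintype.card T)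
    (J : Finset (Fin d)) (g : (Fin d → T) → ℝ) (hg0 : ∀ v, 0 ≤ g v)
    (hg : ∀ v v', (∀ j ∈ J, v j = v' j) → g v = g v') :
    ∑ v, g v * seqProb p v
      ≤ (∏ l : Fin d, (if l ∈ J then L else 1) / Fintype.card T) * ∑ v, g v := by
  induction d with
  | zero => simp [seqProb]
  | succ d ih =>
    set J' : Finset (Fin d) := Finset.univ.filter fun j => j.castSucc ∈ J with hJ'
    have hmem : ∀ j : Fin d, j ∈ J' ↔ j.castSucc ∈ J := fun j => by simp [hJ']
    have hN : (0 : ℝ) < Fintype.card T := by exact_mod_cast Fintype.card_pos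
    have hgJ : ∀ x (v v' : Fin d → T), (∀ j ∈ J', v j = v' j) →
        g (Fin.snoc v x) = g (Fin.snoc v' x) := fun x v v' h => hg _ _ fun j => by
      refine Fin.lastCases (fun _ => by simp) (fun j hj => ?_) j
      simpa using h j ((hmem j).2 hj)
    have IH := fun x => ih (fun l : Fin d => p l.castSucc) (fun l h x => hp0 l.castSucc h x)
      (fun l h => hp1 l.castSucc h) (fun l h x => hpL l.castSucc h x) J' (fun v => g (Fin.snoc v x))
      (fun v => hg0 _) (hgJ x)
    rw [Fin.prod_univ_castSucc, sum_fin_succ_fun, sum_fin_succ_fun]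
    simp only [seqProb_snoc]
    simp only [hmem] at IH
    set C := ∏ i : Fin d, (if i.castSucc ∈ J then L else 1) / (Fintype.card T : ℝ)
    set P := seqProb fun l : Fin d => p l.castSucc with hP
    have hP0 : ∀ v, 0 ≤ P v := fun v => seqProb_nonneg (fun l h x => hp0 l.castSucc h x) v
    by_cases hl : Fin.last d ∈ J
    · rw [if_pos hl, Finset.sum_comm]
      have hL : 0 ≤ L / Fintype.card T :=
        (hp0 (Fin.last d) (fun _ => Classical.arbitrary T) (Classical.arbitrary T)).trans
          (hpL _ _ _)
      calc _ ≤ ∑ x, ∑ v : Fin d → T, L / Fintype.card T * (g (Fin.snoc v x) * P v) := by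
            refine Finset.sum_le_sum fun x _ => Finset.sum_le_sum fun v _ => ?_
            rw [← mul_assoc, mul_comm]
            exact mul_le_mul_of_nonneg_right (hpL _ _ _) (mul_nonneg (hg0 _) (hP0 v))
        _ ≤ ∑ x, L / Fintype.card T * (C * ∑ v : Fin d → T, g (Fin.snoc v x)) := by
            refine Finset.sum_le_sum fun x _ => ?_
            rw [← Finset.mul_sum]
            exact mul_le_mul_of_nonneg_left (IH x) hL
        _ = _ := by
            rw [Finset.sum_comm, ← Finset.mul_sum, ← Finset.mul_sum]; ring
    · rw [if_neg hl]
      have hlast : ∀ x x' (v : Fin d → T), g (Fin.snoc v x) = g (Fin.snoc v x') :=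
        fun x x' v => hg _ _ fun j => by
          refine Fin.lastCases (fun h => absurd h hl) (fun j _ => by simp) j
      have x₀ : T := Classical.arbitrary T
      calc _ = ∑ v : Fin d → T, g (Fin.snoc v x₀) * P v := by
            refine Finset.sum_congr rfl fun v _ => ?_
            rw [Finset.sum_congr rfl fun x _ => show
              g (Fin.snoc v x) * (P v * p (Fin.last d) v x)
                = g (Fin.snoc v x₀) * P v * p (Fin.last d) v x by rw [hlast x x₀]; ring,
              ← Finset.mul_sum, hp1, mul_one]
        _ ≤ C * ∑ v : Fin d → T, g (Fin.snoc v x₀) := IH x₀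
        _ = _ := by
            rw [Finset.sum_congr rfl fun v _ => Finset.sum_congr rfl fun x _ => hlast x x₀ v]
            simp only [Finset.sum_const, Finset.card_univ, nsmul_eq_mul, ← Finset.mul_sum]
            field_simp

/-- The conditional law of the `l`-th entry, given an event about the previous ones, keeps the
pointwise bound of the conditional laws. -/
lemma sum_ite_mul_seqProb_le [DecidableEq T] {κ : ℝ} {d : ℕ}
    (p : (l : Fin d) → (Fin l → T) → T → ℝ) (hp0 : ∀ l h x, 0 ≤ p l h x)
    (hp1 : ∀ l h, ∑ x, p l h x = 1) (hpL : ∀ l h x, p l h x ≤ κ)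
    (l : Fin d) (y : T) (g : (Fin d → T) → ℝ) (hg0 : ∀ v, 0 ≤ g v)
    (hg : ∀ v v', (∀ j < l, v j = v' j) → g v = g v') :
    ∑ v, (if v l = y then g v else 0) * seqProb p v ≤ κ * ∑ v, g v * seqProb p v := by
  induction d with
  | zero => exact l.elim0
  | succ d ih =>
    rw [sum_fin_succ_fun, sum_fin_succ_fun]
    simp only [seqProb_snoc]
    set P := seqProb fun l : Fin d => p l.castSucc with hP
    have hP0 : ∀ v, 0 ≤ P v := fun v => seqProb_nonneg (fun l h x => hp0 l.castSucc h x) v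
    have hlast : ∀ x x' (v : Fin d → T), g (Fin.snoc v x) = g (Fin.snoc v x') :=
      fun x x' v => hg _ _ fun j hj => by
        revert hj
        refine Fin.lastCases (fun h => absurd h (not_lt.2 (Fin.le_last l))) (fun j _ => by simp) j
    have marg : ∀ v : Fin d → T, ∑ x, g (Fin.snoc v x) * (P v * p (Fin.last d) v x)
        = g (Fin.snoc v y) * P v := fun v => by
      rw [Finset.sum_congr rfl fun x _ => show
        g (Fin.snoc v x) * (P v * p (Fin.last d) v x)
          = g (Fin.snoc v y) * P v * p (Fin.last d) v x by rw [hlast x y]; ring,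
        ← Finset.mul_sum, hp1, mul_one]
    simp only [marg]
    induction l using Fin.lastCases with
    | last =>
      rw [Finset.mul_sum]
      refine Finset.sum_le_sum fun v _ => ?_
      simp only [Fin.snoc_last, ite_mul, zero_mul, Finset.sum_ite_eq', Finset.mem_univ, if_true]
      rw [← mul_assoc, mul_comm]
      exact mul_le_mul_of_nonneg_right (hpL _ _ _) (mul_nonneg (hg0 _) (hP0 v))
    | cast l =>
      refine le_trans (le_of_eq ?_) (ih (fun l : Fin d => p l.castSucc)
        (fun l h x => hp0 l.castSucc h x) (fun l h => hp1 l.castSucc h)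
        (fun l h x => hpL l.castSucc h x) l (fun v => g (Fin.snoc v y))
        (fun v => hg0 _) ?_)
      · refine Finset.sum_congr rfl fun v _ => ?_
        simp only [Fin.snoc_castSucc]
        by_cases h : v l = y
        · simp only [h, if_true]; exact marg v
        · simp [h]
      · intro v v' h
        refine hg _ _ fun j => ?_
        refine Fin.lastCases (fun _ => by simp) (fun j hj => ?_) j
        simpa using h j (by simpa using hj)

end seqProb

/-- The law of the hints for a given matrix, as a family of conditional laws. -/
def hintLaw {d n k M : ℕ} {δ : ℝ} (D : SphereDiscretization d δ) (P : Player d n k M)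
    (A : SignMatrix n d) (l : Fin d) (h : Fin l → Fin D.N) (i : Fin D.N) : ℝ :=
  hintProb D (P.submit A l fun j => D.rep (h j)) i

section outcome

variable {d n k M : ℕ} {δ : ℝ} (D : SphereDiscretization d δ) (P : Player d n k M)

lemma outcomeProb_eq (A : SignMatrix n d) (v : Fin d → Fin D.N) :
    outcomeProb D P (A, v)
      = (Fintype.card (SignMatrix n d) : ℝ)⁻¹ * seqProb (hintLaw D P A) v := rfl

lemma outcomeProb_nonneg (ω : Outcome n D) : 0 ≤ outcomeProb D P ω :=
  mul_nonneg (by positivity) (Finset.prod_nonneg fun _ _ => hintProb_nonneg _ _ _)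

lemma sum_outcomeProb (hk : k < d) : ∑ ω : Outcome n D, outcomeProb D P ω = 1 := by
  rw [Fintype.sum_prod_type]
  simp only [outcomeProb_eq, ← Finset.mul_sum]
  rw [Finset.sum_congr rfl fun A _ => sum_seqProb (hintLaw D P A) fun l h => sum_hintProb D hk _]
  have : (Fintype.card (SignMatrix n d) : ℝ) ≠ 0 := by exact_mod_cast Fintype.card_pos.ne'
  simp only [Finset.sum_const, Finset.card_univ, nsmul_eq_mul, mul_one]
  exact inv_mul_cancel₀ this

end outcome

/-! ### Entropy and the leakage of a hint -/

section entropy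

variable {Ω S T : Type} [Fintype Ω]

open Classical in
/-- The weight that `p` gives to the event that `X` takes the value `x`. -/
def marginal (p : Ω → ℝ) (X : Ω → S) (x : S) : ℝ := ∑ ω : Ω, if X ω = x then p ω else 0

lemma marginal_nonneg {p : Ω → ℝ} (hp : ∀ ω, 0 ≤ p ω) (X : Ω → S) (x : S) :
    0 ≤ marginal p X x := by
  classical
  refine Finset.sum_nonneg fun ω _ => ?_
  split_ifs
  exacts [hp ω, le_rfl]

variable [Fintype T]

lemma sum_marginal_pair (p : Ω → ℝ) (Y : Ω → T) (Z : Ω → S) (z : S) :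
    ∑ y, marginal p (fun ω => (Y ω, Z ω)) (y, z) = marginal p Z z := by
  classical
  unfold marginal
  rw [Finset.sum_comm]
  refine Finset.sum_congr rfl fun ω _ => ?_
  by_cases h : Z ω = z <;> simp [h]

variable [Fintype S]

lemma sum_marginal (p : Ω → ℝ) (X : Ω → S) : ∑ x, marginal p X x = ∑ ω, p ω := by
  classical
  unfold marginal
  rw [Finset.sum_comm]
  simp

lemma entropy_eq (p : Ω → ℝ) (X : Ω → S) :
    entropy p X = ∑ x, Real.negMulLog (marginal p X x) := rfl

lemma entropy_equiv (p : Ω → ℝ) (X : Ω → S) (e : S ≃ T) :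
    entropy p (fun ω => e (X ω)) = entropy p X := by
  classical
  rw [entropy_eq, entropy_eq, ← e.sum_comp]
  simp only [marginal, EmbeddingLike.apply_eq_iff_eq]

lemma sum_negMulLog_le [Nonempty T] (q : T → ℝ) (hq : ∀ y, 0 ≤ q y) :
    ∑ y, Real.negMulLog (q y)
      ≤ Real.negMulLog (∑ y, q y) + (∑ y, q y) * Real.log (Fintype.card T) := by
  have hN : (0 : ℝ) < Fintype.card T := by exact_mod_cast Fintype.card_pos
  have h := Real.concaveOn_negMulLog.le_map_sum (t := Finset.univ)
    (w := fun _ : T => (Fintype.card T : ℝ)⁻¹) (p := q) (fun _ _ => by positivity)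
    (by simp) fun y _ => hq y
  simp only [smul_eq_mul, ← Finset.mul_sum] at h
  rw [Real.negMulLog_mul, inv_mul_le_iff₀ hN, mul_add] at h
  refine h.trans (le_of_eq ?_)
  simp only [Real.negMulLog, Real.log_inv]
  field_simp
  ring

/-- Adding a variable with values in `T` raises the entropy by at most `log #T`. -/
lemma entropy_pair_le [Nonempty T] {p : Ω → ℝ} (hp : ∀ ω, 0 ≤ p ω) (h1 : ∑ ω, p ω = 1)
    (Y : Ω → T) (Z : Ω → S) :
    entropy p (fun ω => (Y ω, Z ω)) ≤ entropy p Z + Real.log (Fintype.card T) := by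
  rw [entropy_eq, Fintype.sum_prod_type, Finset.sum_comm]
  calc _ ≤ ∑ z, (Real.negMulLog (marginal p Z z)
          + marginal p Z z * Real.log (Fintype.card T)) := by
        refine Finset.sum_le_sum fun z _ => ?_
        have := sum_negMulLog_le (fun y => marginal p (fun ω => (Y ω, Z ω)) (y, z))
          fun y => marginal_nonneg hp _ _
        rwa [sum_marginal_pair] at this
    _ = _ := by
        rw [Finset.sum_add_distrib, ← Finset.sum_mul, sum_marginal, h1, one_mul]; rfl

/-- Adding a variable whose conditional probabilities are at most `κ` raises the entropy by at
least `-log κ`. -/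
lemma entropy_pair_ge {p : Ω → ℝ} (hp : ∀ ω, 0 ≤ p ω) (h1 : ∑ ω, p ω = 1) {κ : ℝ} (hκ : 0 < κ)
    (Y : Ω → T) (W : Ω → S)
    (h : ∀ y w, marginal p (fun ω => (Y ω, W ω)) (y, w) ≤ κ * marginal p W w) :
    entropy p W - Real.log κ ≤ entropy p (fun ω => (Y ω, W ω)) := by
  rw [entropy_eq p fun ω => (Y ω, W ω), Fintype.sum_prod_type, Finset.sum_comm]
  calc _ = ∑ w, marginal p W w * (-Real.log κ - Real.log (marginal p W w)) := by
        rw [entropy_eq]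
        simp only [mul_sub, Finset.sum_sub_distrib, Real.negMulLog]
        rw [← Finset.sum_mul, sum_marginal, h1]
        simp only [neg_mul, Finset.sum_neg_distrib]
        ring
    _ ≤ _ := by
        refine Finset.sum_le_sum fun w _ => ?_
        rw [← sum_marginal_pair p Y W w, Finset.sum_mul, sum_marginal_pair p Y W w]
        refine Finset.sum_le_sum fun y _ => ?_
        set q := marginal p (fun ω => (Y ω, W ω)) (y, w) with hq
        have hq0 : 0 ≤ q := marginal_nonneg hp _ _
        rcases hq0.eq_or_lt with h0 | h0
        · rw [← h0]; simp
        · have hm : 0 < marginal p W w := by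
            have := h0.trans_le (h y w)
            exact (mul_pos_iff_of_pos_left hκ).1 this
          have hl := Real.log_le_log h0 (h y w)
          rw [Real.log_mul hκ.ne' hm.ne'] at hl
          rw [Real.negMulLog]
          nlinarith

end entropy

/-- Each hint leaks at most the logarithm of the density bound. -/
theorem hintLeakage_le_log {d n k M : ℕ} {δ : ℝ} (hk : k < d) (D : SphereDiscretization d δ)
    (P : Player d n k M) (l : Fin d) (J : Finset (Fin d)) (hJ : ∀ j ∈ J, j < l) :
    hintLeakage D P l J ≤ Real.log (hintDensity d k) := by
  classical
  have hne : Nonempty (Fin D.N) := D.nonempty_cells l.pos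
  have hN : (0 : ℝ) < D.N := by exact_mod_cast (Classical.arbitrary (Fin D.N)).pos
  have hL0 : 0 < hintDensity d k := one_pos.trans_le (one_le_hintDensity hk)
  have hp := outcomeProb_nonneg D P
  have h1 := sum_outcomeProb D P hk
  set Z : Outcome n D → (J → Fin D.N) := fun ω j => ω.2 j with hZ
  have hup := entropy_pair_le hp h1 (fun ω => ω.2 l) Z
  have hlow := entropy_pair_ge hp h1 (div_pos hL0 hN) (fun ω => ω.2 l) (fun ω => (ω.1, Z ω)) (by
    rintro y ⟨a, z⟩
    unfold marginal
    rw [Fintype.sum_prod_type, Fintype.sum_prod_type, Finset.mul_sum]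
    refine Finset.sum_le_sum fun A _ => ?_
    have key := sum_ite_mul_seqProb_le (hintLaw D P A) (fun l h x => hintProb_nonneg D _ x)
      (fun l h => sum_hintProb D hk _) (fun l h x => hintProb_le D hk _ x) l y
      (fun v => if A = a ∧ (fun j : J => v j) = z then (Fintype.card (SignMatrix n d) : ℝ)⁻¹ else 0)
      (fun v => by positivity) (fun v v' h => by
        have : (fun j : J => v j) = fun j : J => v' j := funext fun j => h j (hJ j j.2)
        simp only [this])
    refine le_trans (le_of_eq ?_) (key.trans (le_of_eq ?_))
    · refine Finset.sum_congr rfl fun v _ => ?_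
      by_cases hy : v l = y <;> by_cases ha : A = a <;> by_cases hz : (fun j : J => v j) = z <;>
        simp [hy, ha, hz, hZ, outcomeProb_eq]
    · congr 1
      refine Finset.sum_congr rfl fun v _ => ?_
      by_cases ha : A = a <;> by_cases hz : (fun j : J => v j) = z <;>
        simp [ha, hz, hZ, outcomeProb_eq])
  have hperm : entropy (outcomeProb D P) (fun ω : Outcome n D => (ω.1, ω.2 l, Z ω))
      = entropy (outcomeProb D P) (fun ω : Outcome n D => (ω.2 l, ω.1, Z ω)) :=
    entropy_equiv (outcomeProb D P) (fun ω : Outcome n D => (ω.2 l, ω.1, Z ω))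
      ⟨fun t => (t.2.1, t.1, t.2.2), fun t => (t.2.1, t.1, t.2.2), fun _ => rfl, fun _ => rfl⟩
  rw [Real.log_div hL0.ne' hN.ne'] at hlow
  rw [Fintype.card_fin] at hup
  unfold hintLeakage condMutualInfo
  rw [hperm]
  linarith

lemma log_hintDensity_le {d k : ℕ} (hk : k < d) :
    Real.log (hintDensity d k) ≤ 8 * (k * Real.log d) := by
  rw [log_hintDensity hk]
  rcases Nat.eq_zero_or_pos k with rfl | hk0
  · simp
  have hd : (2 : ℝ) ≤ d := by exact_mod_cast (by omega : 2 ≤ d)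
  have h1 : Real.log 12 ≤ 4 * Real.log d := by
    have h2 : Real.log 12 ≤ Real.log (2 ^ 4) := Real.log_le_log (by norm_num) (by norm_num)
    rw [Real.log_pow] at h2
    have h3 := Real.log_le_log two_pos hd
    push_cast at h2
    linarith
  have h4 : 0 ≤ Real.log d := Real.log_nonneg (by linarith)
  have h5 : (0 : ℝ) ≤ k := by positivity
  nlinarith

/-! ### Decoding the second phase from the names of the responses -/

/-- The names of the possible responses of the second phase: the index of a row or of a hint,
and a number in `[d²]`. -/
abbrev Label (n d : ℕ) : Type := (Fin n ⊕ Fin d) × Fin (d ^ 2)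

/-- The response with a given name. -/
def Label.value {n d : ℕ} (A : SignMatrix n d) (v : Fin d → Vec d) (t : Label n d) :
    Vec d × Fin (d ^ 2) := (Sum.elim (row A) v t.1, t.2)

namespace Player

variable {d n k M : ℕ} (P : Player d n k M)

/-- The transcript of the second phase, from the message and the responses. -/
def decode (P : Player d n k M) (μ : Fin M → Bool) :
    (m : ℕ) → (Fin m → Vec d × Fin (d ^ 2)) → Transcript d
  | 0, _ => []
  | m + 1, f =>
    let T := P.decode μ m fun i => f i.castSucc
    T ++ [(P.query μ T, f (Fin.last m))]

lemma exists_transcript_eq_decode (A : SignMatrix n d) (v : Fin d → Vec d) (m : ℕ) :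
    ∃ t : Fin m → Label n d,
      P.transcript A v m = P.decode (P.message A v) m fun i => (t i).value A v := by
  induction m with
  | zero => exact ⟨fun i => i.elim0, rfl⟩
  | succ m ih =>
    obtain ⟨t, ht⟩ := ih
    set y := P.response A v (P.query (P.message A v) (P.transcript A v m)) with hy
    obtain ⟨s, hs⟩ : ∃ s : Label n d, s.value A v = ((y.1 : Vec d), y.2) := by
      rcases y.1.2 with ⟨j, hj⟩ | ⟨j, hj⟩
      · exact ⟨(Sum.inl j, y.2), by simp [Label.value, hj]⟩
      · exact ⟨(Sum.inr j, y.2), by simp [Label.value, hj]⟩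
    refine ⟨Fin.snoc t s, ?_⟩
    simp only [decode, Fin.snoc_castSucc, Fin.snoc_last, ← ht, hs]
    rfl

/-- The vectors returned at the end, from the message and the names of the responses. -/
def decodedResult {m : ℕ} (μ : Fin M → Bool) (t : Fin m → Label n d) (A : SignMatrix n d)
    (v : Fin d → Vec d) : Fin k → Vec d :=
  P.output μ (P.decode μ m fun i => (t i).value A v)

end Player

/-- The rows that occur among the responses. -/
def usedRows {n d m : ℕ} (t : Fin m → Label n d) : Finset (Fin n) :=
  (Finset.univ.image fun i => (t i).1).toLeft

/-- The hints that occur among the responses. -/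
def usedHints {n d m : ℕ} (t : Fin m → Label n d) : Finset (Fin d) :=
  (Finset.univ.image fun i => (t i).1).toRight

lemma card_usedRows_le {n d m : ℕ} (t : Fin m → Label n d) : (usedRows t).card ≤ m :=
  Finset.card_toLeft_le.trans (Finset.card_image_le.trans (by simp))

lemma card_usedHints_le {n d m : ℕ} (t : Fin m → Label n d) : (usedHints t).card ≤ m :=
  Finset.card_toRight_le.trans (Finset.card_image_le.trans (by simp))

lemma Player.decodedResult_congr {d n k M m : ℕ} (P : Player d n k M) (μ : Fin M → Bool)
    (t : Fin m → Label n d) {A A' : SignMatrix n d} {v v' : Fin d → Vec d}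
    (hA : ∀ j ∈ usedRows t, A j = A' j) (hv : ∀ j ∈ usedHints t, v j = v' j) :
    P.decodedResult μ t A v = P.decodedResult μ t A' v' := by
  have : (fun i => (t i).value A v) = fun i => (t i).value A' v' := by
    funext i
    unfold Label.value
    rcases h : (t i).1 with j | j
    · have hj : j ∈ usedRows t := by
        rw [usedRows, Finset.mem_toLeft]
        exact Finset.mem_image.2 ⟨i, Finset.mem_univ _, h⟩
      simp [row, hA j hj]
    · have hj : j ∈ usedHints t := by
        rw [usedHints, Finset.mem_toRight]
        exact Finset.mem_image.2 ⟨i, Finset.mem_univ _, h⟩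
      simp [hv j hj]
  rw [Player.decodedResult, this, Player.decodedResult]

/-! ### The unused rows of the matrix -/

/-- If the constraint on the entries depends only on the entries in `I`, each of the other entries
independently has at most `b` admissible values. -/
lemma card_filter_forall_le {ι H : Type*} [Fintype ι] [DecidableEq ι] [Fintype H] [Nonempty H]
    (I : Finset ι)
    (good : (ι → H) → H → Prop) [∀ A, DecidablePred (good A)]
    [DecidablePred fun A : ι → H => ∀ j, good A (A j)]
    (hgood : ∀ A A', (∀ j ∈ I, A j = A' j) → ∀ h, good A h → good A' h) (b : ℝ)
    (hb : ∀ A, ((Finset.univ.filter fun h => good A h).card : ℝ) ≤ b) :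
    ((Finset.univ.filter fun A : ι → H => ∀ j, good A (A j)).card : ℝ)
      ≤ (Fintype.card H : ℝ) ^ I.card * b ^ (Fintype.card ι - I.card) := by
  classical
  set e := Equiv.piEquivPiSubtypeProd (fun j : ι => j ∈ I) (fun _ => H) with he
  have hval : ∀ a c (j : ι) (hj : j ∈ I), e.symm (a, c) j = a ⟨j, hj⟩ := fun a c j hj => by
    simp [he, Equiv.piEquivPiSubtypeProd, hj]
  have hval' : ∀ a c (j : ι) (hj : j ∉ I), e.symm (a, c) j = c ⟨j, hj⟩ := fun a c j hj => by
    simp [he, Equiv.piEquivPiSubtypeProd, hj]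
  set c₀ : {j // j ∉ I} → H := fun _ => Classical.arbitrary H
  have hfiber : ∀ a : {j // j ∈ I} → H,
      ∑ c : {j // j ∉ I} → H,
        (if ∀ j, good (e.symm (a, c)) (e.symm (a, c) j) then (1 : ℝ) else 0)
        ≤ b ^ (Fintype.card ι - I.card) := by
    intro a
    set G := Finset.univ.filter fun h => good (e.symm (a, c₀)) h with hG
    have hsub : (Finset.univ.filter fun c : {j // j ∉ I} → H =>
        ∀ j, good (e.symm (a, c)) (e.symm (a, c) j)) ⊆ Fintype.piFinset fun _ => G := by
      intro c hc
      rw [Fintype.mem_piFinset]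
      rintro ⟨j, hj⟩
      have h1 := (Finset.mem_filter.1 hc).2 j
      rw [hval' a c j hj] at h1
      refine Finset.mem_filter.2 ⟨Finset.mem_univ _, hgood _ _ (fun i hi => ?_) _ h1⟩
      rw [hval a c i hi, hval a c₀ i hi]
    rw [Finset.sum_boole]
    have h2 := Finset.card_le_card hsub
    rw [Fintype.card_piFinset, Finset.prod_const, Finset.card_univ] at h2
    have h3 : Fintype.card {j // j ∉ I} = Fintype.card ι - I.card := by
      rw [Fintype.card_subtype_compl]; simp
    rw [h3] at h2
    calc _ ≤ ((G.card ^ (Fintype.card ι - I.card) : ℕ) : ℝ) := by exact_mod_cast h2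
      _ ≤ _ := by
        push_cast
        exact pow_le_pow_left₀ (by positivity) (hb _) _
  have h1 : ((Finset.univ.filter fun A : ι → H => ∀ j, good A (A j)).card : ℝ)
      = ∑ A : ι → H, if ∀ j, good A (A j) then (1 : ℝ) else 0 := by
    rw [Finset.sum_boole]
  rw [h1, ← e.symm.sum_comp, Fintype.sum_prod_type]
  refine (Finset.sum_le_sum fun a _ => hfiber a).trans (le_of_eq ?_)
  simp

open Classical in
/-- Few sign vectors are almost orthogonal to robustly independent vectors. -/
lemma card_almost_orthogonal_le {c : ℝ} (hc : IsHypercubeConstant c) {d k : ℕ} (hk : k < d)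
    {α β : ℝ} (hα : 0 < α) (hβ0 : 0 < β) (hβ1 : β ≤ 1)
    (hαβ : α * (Real.sqrt d / β) ^ (5 / 4 : ℝ) ≤ 1 / 2) (y : Fin k → Vec d)
    (hy : ∀ i, ‖y i‖ = 1)
    (hr : ∀ i, β ≤ ‖(Submodule.span ℝ (y '' Iio i))ᗮ.starProjection (y i)‖) :
    ((Finset.univ.filter fun h : Fin d → ℤˣ => ∀ i, |⟪signVec h, y i⟫| ≤ α).card : ℝ)
      ≤ 2 ^ d * (2 : ℝ) ^ (-(c * (k / 5))) := by
  obtain ⟨p, hp, z, hz, hza⟩ := exists_orthonormal_of_robust hk.le hβ0 hβ1 y hy hr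
  have hd0 : (0 : ℝ) < d := by exact_mod_cast (Nat.zero_le k).trans_lt hk
  have ht : 0 < α * (Real.sqrt d / β) ^ (5 / 4 : ℝ) :=
    mul_pos hα (Real.rpow_pos_of_pos (div_pos (Real.sqrt_pos.2 hd0) hβ0) _)
  have h1 := hc.2 d p z hz _ ht hαβ
  rw [div_le_iff₀ (by positivity), mul_comm _ ((2 : ℝ) ^ d)] at h1
  have hsub : (Finset.univ.filter fun h : Fin d → ℤˣ => ∀ i, |⟪signVec h, y i⟫| ≤ α)
      ⊆ Finset.univ.filter fun h : Fin d → ℤˣ =>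
        ∀ i, |⟪z i, signVec h⟫| ≤ α * (Real.sqrt d / β) ^ (5 / 4 : ℝ) := fun h hh =>
    Finset.mem_filter.2 ⟨Finset.mem_univ _, hza _ _ (Finset.mem_filter.1 hh).2⟩
  calc _ ≤ ((Finset.univ.filter fun h : Fin d → ℤˣ =>
        ∀ i, |⟪z i, signVec h⟫| ≤ α * (Real.sqrt d / β) ^ (5 / 4 : ℝ)).card : ℝ) := by
        exact_mod_cast Finset.card_le_card hsub
    _ ≤ _ := h1
    _ ≤ _ := by
        have hcp := hc.1
        gcongr
        exact one_le_two

open Classical in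
/-- If the returned vectors depend only on the rows in `I`, each of the other rows independently
has to be almost orthogonal to them. -/
lemma card_isWinning_le {c : ℝ} (hc : IsHypercubeConstant c) {d n k : ℕ} (hk : k < d)
    {α β : ℝ} (hα : 0 < α) (hβ0 : 0 < β) (hβ1 : β ≤ 1)
    (hαβ : α * (Real.sqrt d / β) ^ (5 / 4 : ℝ) ≤ 1 / 2)
    (F : SignMatrix n d → Fin k → Vec d) (I : Finset (Fin n))
    (hF : ∀ A A', (∀ j ∈ I, A j = A' j) → F A = F A') :
    ((Finset.univ.filter fun A => IsWinning α β A (F A)).card : ℝ)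
      ≤ Fintype.card (SignMatrix n d) * ((2 : ℝ) ^ (-(c * (k / 5)))) ^ (n - I.card) := by
  set ρ : ℝ := (2 : ℝ) ^ (-(c * (k / 5))) with hρ
  have hρ0 : 0 < ρ := Real.rpow_pos_of_pos two_pos _
  let robust : (Fin k → Vec d) → Prop := fun y => (∀ i, ‖y i‖ = 1) ∧
    ∀ i, β ≤ ‖(Submodule.span ℝ (y '' Iio i))ᗮ.starProjection (y i)‖
  let good : (Fin n → Fin d → ℤˣ) → (Fin d → ℤˣ) → Prop := fun A h =>
    robust (F A) ∧ ∀ i, |⟪signVec h, F A i⟫| ≤ α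
  have hcount := card_filter_forall_le I good
    (fun A A' hAA h hg => by
      have := hF A A' hAA
      simp only [good, this] at hg ⊢
      exact hg) (2 ^ d * ρ) (fun A => by
      by_cases hrob : robust (F A)
      · refine le_trans ?_ (card_almost_orthogonal_le hc hk hα hβ0 hβ1 hαβ _ hrob.1 hrob.2)
        gcongr
        exact fun hg => hg.2
      · rw [Finset.filter_eq_empty_iff.2 fun h _ hg => hrob hg.1]
        simp only [Finset.card_empty, Nat.cast_zero]
        positivity)
  have hIn : I.card ≤ n := by simpa using Finset.card_le_univ I
  have hcH : (Fintype.card (Fin d → ℤˣ) : ℝ) = 2 ^ d := by simp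
  have hcA : (Fintype.card (SignMatrix n d) : ℝ) = (2 ^ d) ^ n := by
    have : Fintype.card (SignMatrix n d) = Fintype.card (Fin n → Fin d → ℤˣ) :=
      Fintype.card_congr (Equiv.refl _)
    rw [this]; simp
  have heq : (2 ^ d : ℝ) ^ I.card * (2 ^ d * ρ) ^ (n - I.card)
      = (2 ^ d) ^ n * ρ ^ (n - I.card) := by
    rw [mul_pow, ← mul_assoc, ← pow_add, Nat.add_sub_cancel' hIn]
  rw [hcH, Fintype.card_fin, heq, ← hcA] at hcount
  refine le_trans ?_ hcount
  have hle : (Finset.univ.filter fun A : SignMatrix n d => IsWinning α β A (F A)).card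
      ≤ (Finset.univ.filter fun A : Fin n → Fin d → ℤˣ => ∀ j, good A (A j)).card := by
    refine Finset.card_le_card_of_injOn (fun A => A) (fun A hA => ?_) fun _ _ _ _ h => h
    have hw : IsWinning α β A (F A) := (Finset.mem_filter.1 hA).2
    exact Finset.mem_coe.2 (Finset.mem_filter.2 ⟨Finset.mem_univ _, fun j =>
      ⟨⟨fun i => (hw i).1, fun i => (hw i).2.2⟩, fun i => (hw i).2.1 j⟩⟩)
  exact_mod_cast hle

open Classical in
/-- For a fixed message and fixed names of the responses, the player wins with small probability:
passing to uniform hints costs a factor `hintDensity` for each hint that is used, and each unused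
row is then independent of the decoded vectors. -/
lemma sum_isWinning_decodedResult_le {c : ℝ} (hc : IsHypercubeConstant c) {d n k M m : ℕ}
    (hk : k < d) {α β δ : ℝ} (hα : 0 < α) (hβ0 : 0 < β) (hβ1 : β ≤ 1)
    (hαβ : α * (Real.sqrt d / β) ^ (5 / 4 : ℝ) ≤ 1 / 2)
    (D : SphereDiscretization d δ) (P : Player d n k M) (μ : Fin M → Bool)
    (t : Fin m → Label n d) :
    ∑ ω : Outcome n D, (if IsWinning α β ω.matrix (P.decodedResult μ t ω.matrix ω.hints)
        then outcomeProb D P ω else 0)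
      ≤ hintDensity d k ^ m * ((2 : ℝ) ^ (-(c * (k / 5)))) ^ (n - m) := by
  have hne : Nonempty (Fin D.N) := D.nonempty_cells ((Nat.zero_le k).trans_lt hk)
  have hN : (0 : ℝ) < D.N := by exact_mod_cast (Classical.arbitrary (Fin D.N)).pos
  have hL1 := one_le_hintDensity hk
  set L := hintDensity d k
  set ρ : ℝ := (2 : ℝ) ^ (-(c * (k / 5))) with hρ
  have hρ0 : 0 < ρ := Real.rpow_pos_of_pos two_pos _
  have hρ1 : ρ ≤ 1 := by
    refine Real.rpow_le_one_of_one_le_of_nonpos one_le_two ?_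
    have := hc.1
    have : 0 ≤ c * ((k : ℝ) / 5) := by positivity
    linarith
  set rep : (Fin d → Fin D.N) → Fin d → Vec d := fun v l => D.rep (v l) with hrep
  set X : SignMatrix n d → (Fin d → Fin D.N) → ℝ := fun A v =>
    if IsWinning α β A (P.decodedResult μ t A (rep v)) then 1 else 0 with hX
  have hX0 : ∀ A v, 0 ≤ X A v := fun A v => by simp only [hX]; positivity
  have hcardA : (0 : ℝ) < Fintype.card (SignMatrix n d) := by exact_mod_cast Fintype.card_pos
  have hmatrix : ∀ v, ∑ A, X A v ≤ Fintype.card (SignMatrix n d) * ρ ^ (n - m) := by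
    intro v
    have h1 := card_isWinning_le hc hk hα hβ0 hβ1 hαβ (fun A => P.decodedResult μ t A (rep v))
      (usedRows t) fun A A' h => P.decodedResult_congr μ t h fun _ _ => rfl
    simp only [hX, Finset.sum_boole]
    refine h1.trans (mul_le_mul_of_nonneg_left ?_ hcardA.le)
    exact pow_le_pow_of_le_one hρ0.le hρ1 (Nat.sub_le_sub_left (card_usedRows_le t) n)
  -- for a given matrix, passing to uniform hints
  have hhints : ∀ A, ∑ v, X A v * seqProb (hintLaw D P A) v
      ≤ L ^ m * ((D.N : ℝ) ^ d)⁻¹ * ∑ v, X A v := by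
    intro A
    have h1 := sum_mul_seqProb_le (L := L) (hintLaw D P A) (fun l h x => hintProb_nonneg D _ x)
      (fun l h => sum_hintProb D hk _)
      (fun l h x => by rw [Fintype.card_fin]; exact hintProb_le D hk _ x)
      (usedHints t) (X A) (hX0 A) (fun v v' h => by
        have := P.decodedResult_congr μ t (A := A) (A' := A) (v := rep v) (v' := rep v')
          (fun _ _ => rfl) fun j hj => by simp [hrep, h j hj]
        simp only [hX, this])
    refine h1.trans (mul_le_mul_of_nonneg_right ?_ (Finset.sum_nonneg fun v _ => hX0 A v))
    rw [Finset.prod_div_distrib, Finset.prod_ite_mem, Finset.univ_inter, Finset.prod_const,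
      Finset.prod_const, Finset.card_univ, Fintype.card_fin, Fintype.card_fin, div_eq_mul_inv]
    gcongr
    exact card_usedHints_le t
  calc _ = ∑ A, (Fintype.card (SignMatrix n d) : ℝ)⁻¹
          * ∑ v, X A v * seqProb (hintLaw D P A) v := by
        rw [Fintype.sum_prod_type]
        refine Finset.sum_congr rfl fun A _ => ?_
        rw [Finset.mul_sum]
        refine Finset.sum_congr rfl fun v _ => ?_
        rw [outcomeProb_eq]
        simp only [hX]
        change (if IsWinning α β A (P.decodedResult μ t A (rep v)) then _ else _) = _
        split_ifs <;> simp
    _ ≤ ∑ A, (Fintype.card (SignMatrix n d) : ℝ)⁻¹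
          * (L ^ m * ((D.N : ℝ) ^ d)⁻¹ * ∑ v, X A v) :=
        Finset.sum_le_sum fun A _ => mul_le_mul_of_nonneg_left (hhints A) (by positivity)
    _ = (Fintype.card (SignMatrix n d) : ℝ)⁻¹ * (L ^ m * ((D.N : ℝ) ^ d)⁻¹)
          * ∑ v, ∑ A, X A v := by
        rw [Finset.sum_comm, Finset.mul_sum]
        refine Finset.sum_congr rfl fun A _ => by ring
    _ ≤ (Fintype.card (SignMatrix n d) : ℝ)⁻¹ * (L ^ m * ((D.N : ℝ) ^ d)⁻¹)
          * ∑ _v : Fin d → Fin D.N, Fintype.card (SignMatrix n d) * ρ ^ (n - m) := by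
        refine mul_le_mul_of_nonneg_left (Finset.sum_le_sum fun v _ => hmatrix v) ?_
        positivity
    _ = _ := by
        simp only [Finset.sum_const, Finset.card_univ, nsmul_eq_mul, Fintype.card_pi,
          Finset.prod_const, Fintype.card_fin, Nat.cast_pow]
        field_simp

/-- A union bound over the messages and the names of the responses. -/
theorem winProb_le {c : ℝ} (hc : IsHypercubeConstant c) {d n k M : ℕ} (m : ℕ)
    (hk : k < d) {α β δ : ℝ} (hα : 0 < α) (hβ0 : 0 < β) (hβ1 : β ≤ 1)
    (hαβ : α * (Real.sqrt d / β) ^ (5 / 4 : ℝ) ≤ 1 / 2)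
    (D : SphereDiscretization d δ) (P : Player d n k M) :
    winProb D P m α β ≤ 2 ^ M * ((n + d) * (d : ℝ) ^ 2) ^ m
      * (hintDensity d k ^ m * ((2 : ℝ) ^ (-(c * (k / 5)))) ^ (n - m)) := by
  classical
  calc winProb D P m α β
      ≤ ∑ ω : Outcome n D, ∑ s : (Fin M → Bool) × (Fin m → Label n d),
          (if IsWinning α β ω.matrix (P.decodedResult s.1 s.2 ω.matrix ω.hints)
            then outcomeProb D P ω else 0) := by
        refine Finset.sum_le_sum fun ω _ => ?_
        obtain ⟨t, ht⟩ := P.exists_transcript_eq_decode ω.matrix ω.hints m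
        have hres : P.result m ω.matrix ω.hints
            = P.decodedResult (P.message ω.matrix ω.hints) t ω.matrix ω.hints := by
          rw [Player.result, Player.decodedResult, ht]
        rw [hres]
        refine le_trans (le_of_eq ?_) (Finset.single_le_sum
          (f := fun s : (Fin M → Bool) × (Fin m → Label n d) =>
            if IsWinning α β ω.matrix (P.decodedResult s.1 s.2 ω.matrix ω.hints)
            then outcomeProb D P ω else 0) (fun s _ => ?_)
          (Finset.mem_univ (P.message ω.matrix ω.hints, t)))
        · simp only
        · have := outcomeProb_nonneg D P ω
          positivity
    _ = ∑ s : (Fin M → Bool) × (Fin m → Label n d), ∑ ω : Outcome n D,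
          (if IsWinning α β ω.matrix (P.decodedResult s.1 s.2 ω.matrix ω.hints)
            then outcomeProb D P ω else 0) := Finset.sum_comm
    _ ≤ ∑ _s : (Fin M → Bool) × (Fin m → Label n d),
          hintDensity d k ^ m * ((2 : ℝ) ^ (-(c * (k / 5)))) ^ (n - m) :=
        Finset.sum_le_sum fun s _ => by
          refine le_trans (le_of_eq ?_)
            (sum_isWinning_decodedResult_le hc hk hα hβ0 hβ1 hαβ D P s.1 s.2)
          congr!
    _ = _ := by simp

/-! ### The number of queries -/

/-- The dimension is large under the hypothesis on `k`. -/
lemma dimension_ge {c : ℝ} (hc0 : 0 < c) (hc2 : c ≤ 2) {d n k M : ℕ} (hn : (n : ℝ) ≤ d / 4 + 1)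
    (hk : k < d)
    (hH : 20 * ((M : ℝ) + 3 * d * Real.log (2 * d) + 1) ≤ k * (c * n)) : (576 : ℝ) ≤ d := by
  have hl2 := Real.log_two_gt_d9
  have hd1 : (1 : ℝ) ≤ d := by exact_mod_cast (Nat.zero_le k).trans_lt hk
  have hkd : (k : ℝ) ≤ d := by exact_mod_cast hk.le
  have hM : (0 : ℝ) ≤ M := by positivity
  have hn0 : (0 : ℝ) ≤ n := by positivity
  -- together with `n ≤ d/4 + 1` this bounds `d` from below, and is used twice to improve on `d ≥ 1`
  have h1 : 30 * Real.log (2 * d) ≤ n := by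
    have h2 : (k : ℝ) * (c * n) ≤ d * (2 * n) := by gcongr
    have h3 : (d : ℝ) * (30 * Real.log (2 * d)) ≤ d * n := by nlinarith
    exact le_of_mul_le_mul_left h3 (by linarith)
  have h2 : Real.log 2 ≤ Real.log (2 * d) := Real.log_le_log two_pos (by linarith)
  have h3 : (2 : ℝ) ^ 7 ≤ 2 * d := by norm_num; linarith
  have h4 := Real.log_le_log (by positivity) h3
  rw [Real.log_pow] at h4
  push_cast at h4
  linarith

/-- The logarithm of the union bound is below `log (1/2)`. The gain of the rows is
`c k n log 2 / 5 ≥ 0.138 c k n`. By the hypothesis on `k`, the message and the names of the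
responses cost at most `c k n / 20`; the hints cost at most `c k d / 60`, and the used rows much
less. As `n` is close to `d / 4`, the gain prevails. -/
lemma log_winProb_bound_lt {c : ℝ} (hc0 : 0 < c) (hc2 : c ≤ 2) {d n k m M : ℕ}
    (hn1 : (n : ℝ) ≤ d / 4 + 1) (hn2 : (d : ℝ) / 4 - 1 ≤ n) (hk : k < d)
    (hH : 20 * ((M : ℝ) + 3 * d * Real.log (2 * d) + 1) ≤ k * (c * n))
    (hm : (m : ℝ) < c / (8 * (30 * Real.log d + c)) * d) :
    M * Real.log 2 + m * (Real.log (n + d) + 2 * Real.log d)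
      + m * Real.log (hintDensity d k) + (n - m) * (-(c * (k / 5)) * Real.log 2)
      < -Real.log 2 := by
  have hd := dimension_ge hc0 hc2 hn1 hk hH
  have hd0 : (0 : ℝ) < d := by linarith
  have hl2 := Real.log_two_gt_d9
  have hl2' := Real.log_two_lt_d9
  have hM : (0 : ℝ) ≤ M := by positivity
  have hn0 : (0 : ℝ) ≤ n := by positivity
  have hm0 : (0 : ℝ) ≤ m := by positivity
  have hk0 : (0 : ℝ) ≤ k := by positivity
  set ℓ := Real.log d with hℓ
  have hlog2d : Real.log (2 * d) = Real.log 2 + ℓ := Real.log_mul two_ne_zero hd0.ne'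
  have hℓ6 : 6 ≤ ℓ := by
    have h := Real.log_le_log (by positivity) (le_trans (by norm_num) hd : (2 : ℝ) ^ 9 ≤ d)
    rw [Real.log_pow] at h
    push_cast at h
    linarith
  have hkpos : 0 < (k : ℝ) := by
    rcases hk0.eq_or_lt with h | h
    · rw [← h, zero_mul, hlog2d] at hH
      nlinarith [mul_nonneg hd0.le (by linarith : 0 ≤ Real.log 2 + ℓ)]
    · exact h
  have hden : 0 < 8 * (30 * ℓ + c) := by linarith
  have hm' : m * (8 * (30 * ℓ + c)) < c * d := by
    rwa [div_mul_eq_mul_div, lt_div_iff₀ hden] at hm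
  have hmℓ : 240 * (m * ℓ) ≤ c * d := by nlinarith [mul_nonneg hm0 hc0.le]
  have hmd : 1440 * (m : ℝ) ≤ c * d := by nlinarith
  have hmd' : (m : ℝ) ≤ d := by nlinarith
  have hlogn : Real.log (n + d) ≤ Real.log 2 + ℓ := by
    rw [← hlog2d]
    exact Real.log_le_log (by linarith) (by linarith)
  have e1 : m * (Real.log (n + d) + 2 * ℓ) ≤ 3 * d * (Real.log 2 + ℓ) := by
    calc m * (Real.log (n + d) + 2 * ℓ) ≤ m * (3 * (Real.log 2 + ℓ)) := by
          gcongr; linarith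
      _ ≤ d * (3 * (Real.log 2 + ℓ)) := by gcongr
      _ = _ := by ring
  -- the density of a hint is at most `d^(4k)` in large dimension
  have e2 : m * Real.log (hintDensity d k) ≤ k * (c * d) / 60 := by
    have h12 : Real.log 12 ≤ ℓ / 2 := by
      have h2 : Real.log 12 ≤ Real.log (2 ^ 4) := Real.log_le_log (by norm_num) (by norm_num)
      rw [Real.log_pow] at h2
      push_cast at h2
      linarith
    rw [log_hintDensity hk]
    calc m * (k * (Real.log 12 + 7 / 2 * ℓ)) ≤ m * (k * (4 * ℓ)) := by gcongr; linarith
      _ = k * (240 * (m * ℓ)) / 60 := by ring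
      _ ≤ _ := by gcongr
  have hKc : 0 < c * k := mul_pos hc0 hkpos
  have e3 : c * k * m ≤ c * k * (d / 720) := by
    refine mul_le_mul_of_nonneg_left ?_ hKc.le
    nlinarith
  rw [hlog2d] at hH
  have e4 : M * Real.log 2 + m * (Real.log (n + d) + 2 * ℓ) + Real.log 2 ≤ c * k * n / 20 := by
    have : M * Real.log 2 ≤ M := by nlinarith
    nlinarith
  have e5 : c * k * (d / 4 - 1) ≤ c * k * n := mul_le_mul_of_nonneg_left hn2 hKc.le
  have e6 : c * k * 576 ≤ c * k * d := mul_le_mul_of_nonneg_left hd hKc.le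
  have e7 : 0.693 * (c * k * n) ≤ Real.log 2 * (c * k * n) := by
    have : 0 ≤ c * k * n := by positivity
    gcongr
    linarith
  have e8 : Real.log 2 * (c * k * m) ≤ 0.7 * (c * k * m) := by
    have : 0 ≤ c * k * m := by positivity
    gcongr
    linarith
  have e9 : (n - m) * (-(c * (k / 5)) * Real.log 2)
      = -(Real.log 2 * (c * k * n) / 5) + Real.log 2 * (c * k * m) / 5 := by ring
  rw [e9]
  have e10 : (k : ℝ) * (c * d) = c * k * d := by ring
  rw [e10] at e2
  linarith

/-- The lower bound on the number of queries, for a deterministic player. -/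
theorem winProb_lt_half {c : ℝ} (hc : IsHypercubeConstant c) {d n k m M : ℕ} {α β δ : ℝ}
    (hn1 : (n : ℝ) ≤ d / 4 + 1) (hn2 : (d : ℝ) / 4 - 1 ≤ n) (hk : k < d)
    (hH : 20 * ((M : ℝ) + 3 * d * Real.log (2 * d) + 1) ≤ k * (c * n))
    (hα : 0 < α) (hβ0 : 0 < β) (hβ1 : β ≤ 1)
    (hαβ : α * (Real.sqrt d / β) ^ (5 / 4 : ℝ) ≤ 1 / 2)
    (hm : (m : ℝ) < c / (8 * (30 * Real.log d + c)) * d)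
    (D : SphereDiscretization d δ) (P : Player d n k M) : winProb D P m α β < 1 / 2 := by
  refine (winProb_le hc m hk hα hβ0 hβ1 hαβ D P).trans_lt ?_
  have hd0 : (0 : ℝ) < d := by exact_mod_cast (Nat.zero_le k).trans_lt hk
  have hlog := log_winProb_bound_lt hc.1 hc.le_two hn1 hn2 hk hH hm
  have hL : 0 < hintDensity d k := one_pos.trans_le (one_le_hintDensity hk)
  set ρ : ℝ := (2 : ℝ) ^ (-(c * (k / 5))) with hρ
  have hρ0 : 0 < ρ := Real.rpow_pos_of_pos two_pos _
  have hlogρ : Real.log ρ = -(c * (k / 5)) * Real.log 2 := Real.log_rpow two_pos _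
  have hlogρ0 : Real.log ρ ≤ 0 := by
    rw [hlogρ]
    have := hc.1
    have : 0 ≤ c * ((k : ℝ) / 5) * Real.log 2 :=
      mul_nonneg (by positivity) (Real.log_nonneg one_le_two)
    linarith
  have hnd : (0 : ℝ) < n + d := by positivity
  -- `n - m` is a truncated difference here, hence only at least the real one
  have hsub : ((n : ℝ) - m) ≤ ((n - m : ℕ) : ℝ) := by
    have : n ≤ (n - m) + m := by omega
    have : (n : ℝ) ≤ ((n - m : ℕ) : ℝ) + m := by exact_mod_cast this
    linarith
  have hmul := mul_le_mul_of_nonpos_right hsub hlogρ0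
  have hhalf : (1 / 2 : ℝ) = Real.exp (-Real.log 2) := by
    rw [Real.exp_neg, Real.exp_log two_pos, one_div]
  rw [hhalf, ← Real.log_lt_iff_lt_exp (by positivity), Real.log_mul (by positivity) (by positivity),
    Real.log_mul (by positivity) (by positivity), Real.log_mul (by positivity) (by positivity),
    Real.log_pow, Real.log_pow, Real.log_pow, Real.log_pow,
    Real.log_mul hnd.ne' (by positivity), Real.log_pow]
  rw [← hlogρ] at hlog
  push_cast
  linarith

end HintGame
end

theorem mainTheorem3 :
    -- the constant `c_H` exists
    (∃ c : ℝ, HintGame.IsHypercubeConstant c) ∧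
    -- the lower bound on the number of queries
    (∀ (c : ℝ), HintGame.IsHypercubeConstant c →
      ∀ (d n k m M : ℕ) (α β δ : ℝ), (n = ⌈(d : ℝ) / 4⌉₊ ∨ n = ⌊(d : ℝ) / 4⌋₊) → 0 < n → k < d →
        20 * ((M : ℝ) + 3 * d * Real.log (2 * d) + 1) / (c * n) ≤ k →
        0 < α → α ≤ 1 → 0 < β → β ≤ 1 → 0 < δ →
        α * (Real.sqrt d / β) ^ (5 / 4 : ℝ) ≤ 1 / 2 →
        ∀ (D : HintGame.SphereDiscretization d δ)
          -- a possibly randomized player: a random strategy, drawn with the seed `s`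
          (S : Type) (_ : MeasurableSpace S) (μ : Measure S) (_ : IsProbabilityMeasure μ)
          (P : S → HintGame.Player d n k M),
          1 / 2 ≤ ∫ s, HintGame.winProb D (P s) m α β ∂μ →
          c / (8 * (30 * Real.log d + c)) * d ≤ m) ∧
    -- the information on the matrix that each hint leaks
    (∃ C : ℝ, 0 < C ∧ ∀ (d n k M : ℕ) (δ : ℝ), k < d → 0 < δ →
      ∀ (D : HintGame.SphereDiscretization d δ) (P : HintGame.Player d n k M)
        (l : Fin d) (J : Finset (Fin d)), (∀ j ∈ J, j < l) →
        HintGame.hintLeakage D P l J ≤ C * (k * Real.log d)) := by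
  refine ⟨⟨_, HintGame.isHypercubeConstant_one_div⟩, ?_, 8, by norm_num, ?_⟩
  · intro c hc d n k m M α β δ hn hn0 hk hH hα _ hβ0 hβ1 _ hαβ D S _ μ _ P hwin
    by_contra hlt
    push Not at hlt
    have hn0' : (0 : ℝ) < n := by exact_mod_cast hn0
    have hd4 : (0 : ℝ) ≤ (d : ℝ) / 4 := by positivity
    have hnb : (n : ℝ) ≤ d / 4 + 1 ∧ (d : ℝ) / 4 - 1 ≤ n := by
      rcases hn with h | h
      · have h1 := Nat.ceil_lt_add_one hd4
        have h2 := Nat.le_ceil ((d : ℝ) / 4)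
        rw [← h] at h1 h2
        constructor <;> linarith
      · have h1 := Nat.floor_le hd4
        have h2 := Nat.lt_floor_add_one ((d : ℝ) / 4)
        rw [← h] at h1 h2
        constructor <;> linarith
    rw [div_le_iff₀ (mul_pos hc.1 hn0')] at hH
    -- a non-integrable function would have integral zero
    have hint : Integrable (fun s => HintGame.winProb D (P s) m α β) μ := by
      by_contra h
      rw [integral_undef h] at hwin
      norm_num at hwin
    obtain ⟨s, hs⟩ := exists_integral_le hint
    have := HintGame.winProb_lt_half hc hnb.1 hnb.2 hk hH hα hβ0 hβ1 hαβ hlt D (P s)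
    linarith
  · intro d n k M δ hk _ D P l J hJ
    exact (HintGame.hintLeakage_le_log hk D P l J hJ).trans (HintGame.log_hintDensity_le hk)
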